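/- **Setting.** Let $(M^{2n+1},J,\theta)$, $n\ge 1$, be a strictly pseudoconvex pseudohermitian manifold: $\theta$ is a smooth contact form, $J$ is a formally integrable complex structure on $H=\ker\theta$, and $d\theta(X,JX)>0$ for $0\ne X\in H$. Let $T$ be the Reeb field ($\theta(T)=1$, $T\lrcorner d\theta=0$), let $\{\theta,\theta^\alpha,\theta^{\bar\alpha}\}$ be a local admissible coframe with dual frame $\{T,Z_\alpha,Z_{\bar\alpha}\}$, where $Z_\alpha\in T^{1,0}$, and write $d\theta=ih_{\alpha\bar\beta}\,\theta^\alpha\wedge\theta^{\bar\beta}$. The Tanaka–Webster connection forms $\omega_\alpha{}^\beta$ and the torsion $A_{\alpha\beta}$ are determined by $$d\theta^\beta=\theta^\alpha\wedge\omega_\alpha{}^\beta+\theta\wedge\tau^\beta,\quad \tau_\alpha=A_{\alpha\beta}\theta^\beta,\quad \omega_{\alpha\bar\beta}+\omega_{\bar\beta\alpha}=dh_{\alpha\bar\beta},\quad A_{\alpha\beta}=A_{\beta\alpha},$$ indices being raised and lowered with $h_{\alpha\bar\beta}$. The Ricci tensor $R_{\alpha\bar\beta}$ is the coefficient of $\theta^\alpha\wedge\theta^{\bar\beta}$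 in $d\omega_\gamma{}^\gamma$, and $R=R_\alpha{}^\alpha$. Put $\Delta_b=-(\nabla^\alpha\nabla_\alpha+\nabla_\alpha\nabla^\alpha)$, $\nabla_0=\nabla_T$, $|A|^2=A_{\alpha\beta}A^{\alpha\beta}$, $P_{\alpha\bar\beta}=\frac1{n+2}\big(R_{\alpha\bar\beta}-\frac{1}{2(n+1)}Rh_{\alpha\bar\beta}\big)$, $P=\frac{R}{2(n+1)}$ and $\mathring P_{\alpha\bar\beta}=P_{\alpha\bar\beta}-\frac Pn h_{\alpha\bar\beta}$. The CR Paneitz operator is $$\begin{aligned}P_4f={}&\Delta_b^2f+\nabla_0^2f-4\,\mathrm{Im}\,\nabla^\alpha(A_{\alpha\beta}\nabla^\beta f)+4\,\mathrm{Re}\,\nabla_{\bar\beta}(\mathring P^{\alpha\bar\beta}\nabla_\alpha f)\\&-\tfrac{4(n^2-1)}n\,\mathrm{Re}\,\nabla^\beta(P\nabla_\beta f)+\tfrac{n-1}2Q_4f,\end{aligned}$$ $$Q_4=\tfrac{2(n+1)^2}{n(n+2)}\Delta_bP-\tfrac4{n(n+2)}\mathrm{Im}\,\nabla^\alpha\nabla^\beta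 A_{\alpha\beta}-\tfrac{2(n-1)}n|A|^2-\tfrac{2(n+1)}n|\mathring P|^2+\tfrac{2(n-1)(n+1)^2}{n^2}P^2.$$ The manifold is *pseudo-Einstein* if $R_{\alpha\bar\beta}-\frac1nRh_{\alpha\bar\beta}=0$ (when $n\ge2$), respectively $\nabla_\alpha R-i\nabla^\beta A_{\alpha\beta}=0$ (when $n=1$). On a pseudo-Einstein manifold the *$Q'$-curvature* is $Q_4'=\frac{4}{(n-1)^2}P_4(1)$ when $n\ge2$. When $n=1$ it is the formal limit of this expression as $n\to1$, that is: $Q_4'$ is the value at $n=1$ of a linear combination of $\Delta_bR$, $\mathrm{Im}\,\nabla^\alpha\nabla^\beta A_{\alpha\beta}$, $|A|^2$, $|\mathring P|^2$, $R^2$ whose coefficients are rational functions of $n$ without poles at the integers $n\ge1$, and which equals $\frac4{(n-1)^2}P_4(1)$ on every pseudo-Einstein manifold of every dimension $2n+1$ with $n\ge2$. **Lemma.** Let $(M^{2n+1},J,\theta)$ be a pseudo-Einstein manifold, $n\ge1$. Then the $Q'$-curvature is given by $$Q_4'=\frac2{n^2}\Delta_bR-\frac4n|A|^2+\frac1{n^2}R^2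 .$$ In particular, when $n=1$ it is given by $Q_4'=2\Delta_bR-4|A|^2+R^2$. -/

import Mathlib

open scoped Manifold ContDiff

noncomputable section

namespace CRGeometry

universe u

/-- The model space `ℝ^{2n+1}` of a manifold of CR dimension `n`. -/
abbrev Model (n : ℕ) : Type := EuclideanSpace ℝ (Fin (2 * n + 1))

/-- Complex vector fields `Z = re + i im` (sections of `ℂ ⊗ TM`, without regularity). -/
structure CField (n : ℕ) (M : Type u) [TopologicalSpace M] [ChartedSpace (Model n) M] where
  /-- the real part -/
  re : (p : M) → TangentSpace (𝓡 (2 * n + 1)) p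
  /-- the imaginary part -/
  im : (p : M) → TangentSpace (𝓡 (2 * n + 1)) p

/-- Complex-valued differential `1`-forms (without regularity). -/
abbrev CForm (n : ℕ) (M : Type u) [TopologicalSpace M] [ChartedSpace (Model n) M] : Type u :=
  (p : M) → TangentSpace (𝓡 (2 * n + 1)) p →L[ℝ] ℂ

section Basic

variable {n : ℕ} {M : Type u} [TopologicalSpace M] [ChartedSpace (Model n) M]

namespace CField

/-- A real vector field, as a complex one. -/
def ofReal (X : (p : M) → TangentSpace (𝓡 (2 * n + 1)) p) : CField n M := ⟨X, fun _ => 0⟩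

/-- The conjugate vector field. -/
def conj (Z : CField n M) : CField n M := ⟨Z.re, fun p => -Z.im p⟩

/-- The complex bilinear extension of the Lie bracket of vector fields. -/
def bracket (Z W : CField n M) : CField n M :=
  ⟨fun p => VectorField.mlieBracket (𝓡 (2 * n + 1)) Z.re W.re p
      - VectorField.mlieBracket (𝓡 (2 * n + 1)) Z.im W.im p,
   fun p => VectorField.mlieBracket (𝓡 (2 * n + 1)) Z.re W.im p
      + VectorField.mlieBracket (𝓡 (2 * n + 1)) Z.im W.re p⟩

/-- The derivative `Z f` of a complex-valued function along a complex vector field. -/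
def D (Z : CField n M) (f : M → ℂ) (p : M) : ℂ :=
  let df : TangentSpace (𝓡 (2 * n + 1)) p →L[ℝ] ℂ := mfderiv (𝓡 (2 * n + 1)) 𝓘(ℝ, ℂ) f p
  df (Z.re p) + Complex.I * df (Z.im p)

end CField

namespace CForm

/-- The value `φ(Z)` of a form on a complex vector field (complex linear in `Z`). -/
def ap (φ : CForm n M) (Z : CField n M) (p : M) : ℂ :=
  φ p (Z.re p) + Complex.I * φ p (Z.im p)

/-- The conjugate form. -/
def conj (φ : CForm n M) : CForm n M :=
  fun p => (Complex.conjCLE : ℂ →L[ℝ] ℂ).comp (φ p)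

/-- The exterior derivative, `dφ(Z, W) = Z(φ(W)) - W(φ(Z)) - φ([Z, W])`. -/
def extd (φ : CForm n M) (Z W : CField n M) (p : M) : ℂ :=
  Z.D (φ.ap W) p - W.D (φ.ap Z) p - φ.ap (Z.bracket W) p

/-- The wedge product of two `1`-forms, `(φ ∧ ψ)(Z, W) = φ(Z) ψ(W) - φ(W) ψ(Z)`. -/
def wedge (φ ψ : CForm n M) (Z W : CField n M) (p : M) : ℂ :=
  φ.ap Z p * ψ.ap W p - φ.ap W p * ψ.ap Z p

end CForm

/-- The complexification of a real `1`-form. -/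
def complexify (θ : (p : M) → TangentSpace (𝓡 (2 * n + 1)) p →L[ℝ] ℝ) : CForm n M :=
  fun p => Complex.ofRealCLM.comp (θ p)

/-- `Z` is a section of `T^{1,0}` over `U`, where `T^{1,0} ⊆ ℂ ⊗ H` is the `+i`-eigenspace of `J`
on `H = ker θ`: one has `Z = X - i J X` with `X` in `H`. -/
def IsOneZeroOn (θ : (p : M) → TangentSpace (𝓡 (2 * n + 1)) p →L[ℝ] ℝ)
    (J : (p : M) → TangentSpace (𝓡 (2 * n + 1)) p →L[ℝ] TangentSpace (𝓡 (2 * n + 1)) p)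
    (Z : CField n M) (U : Set M) : Prop :=
  ∀ p ∈ U, θ p (Z.re p) = 0 ∧ Z.im p = -J p (Z.re p)

end Basic

section Structures

variable {n : ℕ} {M : Type u} [TopologicalSpace M] [ChartedSpace (Model n) M]
  [IsManifold (𝓡 (2 * n + 1)) ∞ M]

/-- `X` is smooth on `U`, as a section of the tangent bundle. -/
def SmoothFieldOn (X : (p : M) → TangentSpace (𝓡 (2 * n + 1)) p) (U : Set M) : Prop :=
  ContMDiffOn (𝓡 (2 * n + 1)) (𝓡 (2 * n + 1)).tangent ∞
    (fun p => (⟨p, X p⟩ : TangentBundle (𝓡 (2 * n + 1)) M)) U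

/-- A complex vector field is smooth on `U`. -/
def CField.SmoothOn (Z : CField n M) (U : Set M) : Prop :=
  SmoothFieldOn Z.re U ∧ SmoothFieldOn Z.im U

variable (n M) in
/-- A strictly pseudoconvex pseudohermitian structure `(J, θ)` on a manifold `M` of dimension
`2n+1`: a smooth real `1`-form `θ` and a smooth, formally integrable complex structure `J` on
`H = ker θ`, such that `dθ(X, J X) > 0` for `X ≠ 0` in `H`.  Only the restriction of `J p` to
`ker (θ p)` is meaningful, and only that restriction is ever used. -/
structure Pseudohermitian where
  /-- the contact form -/
  θ : (p : M) → TangentSpace (𝓡 (2 * n + 1)) p →L[ℝ] ℝ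
  /-- the complex structure on `ker θ` -/
  J : (p : M) → TangentSpace (𝓡 (2 * n + 1)) p →L[ℝ] TangentSpace (𝓡 (2 * n + 1)) p
  θ_ne_zero : ∀ p, θ p ≠ 0
  θ_smooth : ∀ U : Set M, IsOpen U → ∀ X, SmoothFieldOn X U →
    ContMDiffOn (𝓡 (2 * n + 1)) 𝓘(ℝ, ℝ) ∞ (fun p => θ p (X p)) U
  J_mem : ∀ p v, θ p v = 0 → θ p (J p v) = 0
  J_sq : ∀ p v, θ p v = 0 → J p (J p v) = -v
  J_smooth : ∀ U : Set M, IsOpen U → ∀ X, SmoothFieldOn X U → (∀ p ∈ U, θ p (X p) = 0) →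
    SmoothFieldOn (fun p => J p (X p)) U
  /-- formal integrability: `[T^{1,0}, T^{1,0}] ⊆ T^{1,0}` -/
  integrable : ∀ U : Set M, IsOpen U → ∀ Z W : CField n M, Z.SmoothOn U → W.SmoothOn U →
    IsOneZeroOn θ J Z U → IsOneZeroOn θ J W U → IsOneZeroOn θ J (Z.bracket W) U
  /-- strict pseudoconvexity: `dθ(X, J X)` is positive for `X ≠ 0` in `H` -/
  pseudoconvex : ∀ U : Set M, IsOpen U → ∀ X, SmoothFieldOn X U → (∀ p ∈ U, θ p (X p) = 0) →
    ∀ p ∈ U, X p ≠ 0 →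
      0 < ((complexify θ).extd (CField.ofReal X) (CField.ofReal fun q => J q (X q)) p).re

/-- An admissible coframe `{θ, θ^α, θ^{ᾱ}}` over an open set `U`, with the dual frame
`{T, Z_α, Z_{ᾱ}}`; here `T` is the Reeb vector field, `θ(T) = 1` and `dθ(T, ·) = 0`. -/
structure AdmissibleFrame (S : Pseudohermitian n M) (U : Set M) where
  isOpen : IsOpen U
  /-- the Reeb vector field `T` -/
  reeb : (p : M) → TangentSpace (𝓡 (2 * n + 1)) p
  /-- the frame `Z_α` of `T^{1,0}` -/
  Z : Fin n → CField n M
  /-- the `(1,0)`-forms `θ^α` -/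
  ϑ : Fin n → CForm n M
  reeb_smooth : SmoothFieldOn reeb U
  Z_smooth : ∀ α, (Z α).SmoothOn U
  ϑ_smooth : ∀ α, ∀ V : Set M, IsOpen V → V ⊆ U → ∀ X, SmoothFieldOn X V →
    ContMDiffOn (𝓡 (2 * n + 1)) 𝓘(ℝ, ℂ) ∞ (fun p => ϑ α p (X p)) V
  θ_reeb : ∀ p ∈ U, S.θ p (reeb p) = 1
  reeb_contract : ∀ V : Set M, IsOpen V → V ⊆ U → ∀ X, SmoothFieldOn X V → ∀ p ∈ V,
    (complexify S.θ).extd (CField.ofReal reeb) (CField.ofReal X) p = 0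
  Z_oneZero : ∀ α, IsOneZeroOn S.θ S.J (Z α) U
  ϑ_reeb : ∀ α, ∀ p ∈ U, ϑ α p (reeb p) = 0
  ϑ_Z : ∀ α β, ∀ p ∈ U, (ϑ α).ap (Z β) p = if α = β then 1 else 0
  ϑ_conj_Z : ∀ α β, ∀ p ∈ U, (ϑ α).ap (Z β).conj p = 0

namespace AdmissibleFrame

variable {S : Pseudohermitian n M} {U : Set M} (F : AdmissibleFrame S U)

/-- The Reeb field as a complex vector field. -/
def T : CField n M := CField.ofReal F.reeb

/-- `Z_{ᾱ}`, the conjugate of `Z_α`. -/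
def Zbar (α : Fin n) : CField n M := (F.Z α).conj

/-- The Levi form `h_{αβ̄}`, from `dθ = i h_{αβ̄} θ^α ∧ θ^{β̄}`. -/
def h (α β : Fin n) (p : M) : ℂ :=
  -Complex.I * (complexify S.θ).extd (F.Z α) (F.Zbar β) p

/-- The inverse `h^{αβ̄}` of the Levi form: `∑_β h^{αβ̄} h_{γβ̄} = δ^α_γ`. -/
def hInv (α β : Fin n) (p : M) : ℂ :=
  (Matrix.of fun a b => F.h a b p)⁻¹ β α

/-! ### The Tanaka–Webster connection

The connection forms `ω_α^β` and the torsion `A_{αβ}` are determined by Webster's relations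

* `dθ^β = θ^α ∧ ω_α^β + θ ∧ τ^β`, where `τ_α = A_{αβ} θ^β`,
* `ω_{αβ̄} + ω_{β̄α} = dh_{αβ̄}`,
* `A_{αβ} = A_{βα}`.

Evaluating the first relation on `(Z_{γ̄}, Z_α)`, `(T, Z_α)` and `(T, Z_{γ̄})`, where
`dθ^β(V, W) = -θ^β([V, W])` for frame fields `V`, `W`, and the second one on `Z_γ`,
gives the four definitions below. -/

/-- `ω_α^β(Z_{γ̄}) = θ^β([Z_{γ̄}, Z_α])`. -/
def connBar (γ α β : Fin n) (p : M) : ℂ := (F.ϑ β).ap ((F.Zbar γ).bracket (F.Z α)) p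

/-- `ω_α^β(T) = θ^β([T, Z_α])`. -/
def connReeb (α β : Fin n) (p : M) : ℂ := (F.ϑ β).ap (F.T.bracket (F.Z α)) p

/-- `ω_α^β(Z_γ) = h^{βσ̄} ω_{ασ̄}(Z_γ)` with `ω_{ασ̄}(Z_γ) = Z_γ h_{ασ̄} - ω_{σ̄α}(Z_γ)`, where
`ω_{σ̄α}(Z_γ)` is the conjugate of `ω_{σᾱ}(Z_{γ̄}) = h_{μᾱ} ω_σ^μ(Z_{γ̄})`. -/
def connHol (γ α β : Fin n) (p : M) : ℂ :=
  ∑ σ, F.hInv β σ p *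
    ((F.Z γ).D (F.h α σ) p - starRingEnd ℂ (∑ μ, F.h μ α p * F.connBar γ σ μ p))

/-- The connection form `ω_α^β`. -/
def conn (α β : Fin n) : CForm n M := fun p =>
  (∑ γ, (F.connHol γ α β p • F.ϑ γ p + F.connBar γ α β p • CForm.conj (F.ϑ γ) p))
    + F.connReeb α β p • complexify S.θ p

/-- The torsion `A_{αβ}`: the conjugate of `A_{ᾱβ̄} = h_{γᾱ} A^γ_{β̄}`, where
`A^γ_{β̄} = τ^γ(Z_{β̄}) = -θ^γ([T, Z_{β̄}])`. -/
def A (α β : Fin n) (p : M) : ℂ :=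
  starRingEnd ℂ (∑ γ, F.h γ α p * -(F.ϑ γ).ap (F.T.bracket (F.Zbar β)) p)

/-! ### Covariant derivatives of components, and contractions -/

/-- `∇_{β̄} τ_α` for a `(1,0)`-form `τ_α θ^α`. -/
def nablaBarForm (τ : Fin n → M → ℂ) (β α : Fin n) (p : M) : ℂ :=
  (F.Zbar β).D (τ α) p - ∑ σ, (F.conn α σ).ap (F.Zbar β) p * τ σ p

/-- `∇_β τ_{ᾱ}` for a `(0,1)`-form `τ_{ᾱ} θ^{ᾱ}`. -/
def nablaFormBar (τ : Fin n → M → ℂ) (β α : Fin n) (p : M) : ℂ :=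
  (F.Z β).D (τ α) p - ∑ σ, (CForm.conj (F.conn α σ)).ap (F.Z β) p * τ σ p

/-- `∇_{γ̄} B_{αβ}` for a tensor `B_{αβ} θ^α ⊗ θ^β`. -/
def nablaBarTwo (B : Fin n → Fin n → M → ℂ) (γ α β : Fin n) (p : M) : ℂ :=
  (F.Zbar γ).D (B α β) p - ∑ σ, (F.conn α σ).ap (F.Zbar γ) p * B σ β p
    - ∑ σ, (F.conn β σ).ap (F.Zbar γ) p * B α σ p

/-- The divergence `∇^α τ_α = h^{αβ̄} ∇_{β̄} τ_α` of a `(1,0)`-form. -/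
def div (τ : Fin n → M → ℂ) (p : M) : ℂ :=
  ∑ α, ∑ β, F.hInv α β p * F.nablaBarForm τ β α p

/-- The divergence `∇_α τ^α = h^{αβ̄} ∇_α τ_{β̄}` of a `(0,1)`-form `τ_{β̄} θ^{β̄}`. -/
def divBar (τ : Fin n → M → ℂ) (p : M) : ℂ :=
  ∑ α, ∑ β, F.hInv α β p * F.nablaFormBar τ α β p

/-- The divergence `∇_{β̄} v^{β̄}` of a `(0,1)`-vector field `v^{β̄} Z_{β̄}`. -/
def divVecBar (v : Fin n → M → ℂ) (p : M) : ℂ :=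
  ∑ β, ((F.Zbar β).D (v β) p + ∑ σ, (CForm.conj (F.conn σ β)).ap (F.Zbar β) p * v σ p)

/-- `∇_α f`. -/
def grad (f : M → ℂ) (α : Fin n) (p : M) : ℂ := (F.Z α).D f p

/-- `∇_{ᾱ} f`. -/
def gradBar (f : M → ℂ) (α : Fin n) (p : M) : ℂ := (F.Zbar α).D f p

/-- `∇^α f = h^{αβ̄} ∇_{β̄} f`. -/
def gradUp (f : M → ℂ) (α : Fin n) (p : M) : ℂ := ∑ β, F.hInv α β p * F.gradBar f β p

/-- The sublaplacian `Δ_b f = -(∇^α ∇_α f + ∇_α ∇^α f)`. -/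
def sublaplacian (f : M → ℂ) (p : M) : ℂ := -(F.div (F.grad f) p + F.divBar (F.gradBar f) p)

/-- `∇_0 f = T f`. -/
def nabla0 (f : M → ℂ) (p : M) : ℂ := F.T.D f p

/-- `A^{αβ} = h^{αγ̄} h^{βσ̄} A_{γ̄σ̄}`, with `A_{γ̄σ̄}` the conjugate of `A_{γσ}`. -/
def AUp (α β : Fin n) (p : M) : ℂ :=
  ∑ γ, ∑ σ, F.hInv α γ p * F.hInv β σ p * starRingEnd ℂ (F.A γ σ p)

/-- `|A_{αβ}|² = A_{αβ} A^{αβ}`. -/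
def normSqA (p : M) : ℂ := ∑ α, ∑ β, F.A α β p * F.AUp α β p

/-- `∇^β A_{αβ} = h^{βγ̄} ∇_{γ̄} A_{αβ}`. -/
def divA (α : Fin n) (p : M) : ℂ := ∑ β, ∑ γ, F.hInv β γ p * F.nablaBarTwo F.A γ α β p

/-- `Im (∇^α ∇^β A_{αβ})`. -/
def imDivDivA (p : M) : ℂ := ((F.div F.divA p).im : ℂ)

/-! ### Curvature -/

/-- The curvature form `Π_α^β = dω_α^β - ω_α^γ ∧ ω_γ^β`, evaluated on two vector fields. -/
def curvForm (α β : Fin n) (V W : CField n M) (p : M) : ℂ :=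
  (F.conn α β).extd V W p - ∑ γ, CForm.wedge (F.conn α γ) (F.conn γ β) V W p

/-- The curvature `R_α^β_{γδ̄}`, the coefficient of `θ^γ ∧ θ^{δ̄}` in `Π_α^β`. -/
def curv (α β γ δ : Fin n) (p : M) : ℂ := F.curvForm α β (F.Z γ) (F.Zbar δ) p

/-- The pseudohermitian Ricci tensor `R_{αβ̄} = R_γ^γ_{αβ̄}`. -/
def ricci (α β : Fin n) (p : M) : ℂ := ∑ γ, F.curv γ γ α β p

/-- The pseudohermitian scalar curvature `R = R_α^α = h^{αβ̄} R_{αβ̄}`. -/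
def scal (p : M) : ℂ := ∑ α, ∑ β, F.hInv α β p * F.ricci α β p

/-- The trace `P = R / (2(n+1))` of the pseudohermitian Schouten tensor. -/
def schoutenTrace (p : M) : ℂ := F.scal p / (2 * ((n : ℂ) + 1))

/-- The pseudohermitian Schouten tensor
`P_{αβ̄} = (R_{αβ̄} - R h_{αβ̄} / (2(n+1))) / (n+2)`. -/
def schouten (α β : Fin n) (p : M) : ℂ :=
  (F.ricci α β p - F.scal p / (2 * ((n : ℂ) + 1)) * F.h α β p) / ((n : ℂ) + 2)

/-- The tracefree part `P_{αβ̄} - (P/n) h_{αβ̄}` of the Schouten tensor. -/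
def schoutenTF (α β : Fin n) (p : M) : ℂ :=
  F.schouten α β p - F.schoutenTrace p / (n : ℂ) * F.h α β p

/-- The tracefree Schouten tensor with raised indices, `h^{αμ̄} h^{νβ̄} P_{νμ̄}`. -/
def schoutenTFUp (α β : Fin n) (p : M) : ℂ :=
  ∑ μ, ∑ ν, F.hInv α μ p * F.hInv ν β p * F.schoutenTF ν μ p

/-- The squared norm of the tracefree Schouten tensor. -/
def normSqSchoutenTF (p : M) : ℂ := ∑ α, ∑ β, F.schoutenTF α β p * F.schoutenTFUp α β p

/-! ### The CR Paneitz operator -/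

/-- The zeroth order coefficient `Q₄` of the CR Paneitz operator. -/
def Q4 (p : M) : ℂ :=
  2 * ((n : ℂ) + 1) ^ 2 / ((n : ℂ) * ((n : ℂ) + 2)) * F.sublaplacian F.schoutenTrace p
    - 4 / ((n : ℂ) * ((n : ℂ) + 2)) * F.imDivDivA p
    - 2 * ((n : ℂ) - 1) / (n : ℂ) * F.normSqA p
    - 2 * ((n : ℂ) + 1) / (n : ℂ) * F.normSqSchoutenTF p
    + 2 * ((n : ℂ) - 1) * ((n : ℂ) + 1) ^ 2 / (n : ℂ) ^ 2 * F.schoutenTrace p ^ 2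

/-- The CR Paneitz operator `P₄` on real-valued functions:
`Δ_b² f + ∇_0² f - 4 Im ∇^α(A_{αβ} ∇^β f) + 4 Re ∇_{β̄}(P̊^{αβ̄} ∇_α f)
  - (4(n²-1)/n) Re ∇^β(P ∇_β f) + ((n-1)/2) Q₄ f`, where `P̊` is the tracefree Schouten tensor. -/
def P4 (f : M → ℝ) (p : M) : ℂ :=
  let g : M → ℂ := fun q => (f q : ℂ)
  F.sublaplacian (F.sublaplacian g) p + F.nabla0 (F.nabla0 g) p
    - 4 * ((F.div (fun α q => ∑ β, F.A α β q * F.gradUp g β q) p).im : ℂ)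
    + 4 * ((F.divVecBar (fun β q => ∑ α, F.schoutenTFUp α β q * F.grad g α q) p).re : ℂ)
    - 4 * ((n : ℂ) ^ 2 - 1) / (n : ℂ)
        * ((F.div (fun β q => F.schoutenTrace q * F.grad g β q) p).re : ℂ)
    + ((n : ℂ) - 1) / 2 * F.Q4 p * g p

end AdmissibleFrame

/-- Pseudo-Einstein: `R_{αβ̄} - (1/n) R h_{αβ̄} = 0` if `n ≥ 2`, and
`∇_α R - i ∇^β A_{αβ} = 0` if `n = 1`. -/
def Pseudohermitian.IsPseudoEinstein (S : Pseudohermitian n M) : Prop :=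
  ∀ (U : Set M) (F : AdmissibleFrame S U), ∀ p ∈ U,
    (2 ≤ n → ∀ α β, F.ricci α β p - 1 / (n : ℂ) * F.scal p * F.h α β p = 0) ∧
    (n = 1 → ∀ α, F.grad F.scal α p - Complex.I * F.divA α p = 0)

end Structures

/-! ### The `Q'`-curvature -/

/-- A linear combination of the scalar invariants `Δ_b R`, `Im ∇^α ∇^β A_{αβ}`, `|A|²`, `|P̊|²`
and `R²` whose coefficients are rational functions of the dimension parameter, written over a
common denominator. -/
structure DimExpr where
  /-- numerators -/
  num : Fin 5 → Polynomial ℝ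
  /-- common denominator -/
  den : Polynomial ℝ

/-- The coefficient number `i` of `E` at the dimension `n`. -/
def DimExpr.coeff (E : DimExpr) (n : ℕ) (i : Fin 5) : ℂ :=
  (((E.num i).eval (n : ℝ) / E.den.eval (n : ℝ) : ℝ) : ℂ)

/-- The value of `E` on a pseudohermitian manifold of CR dimension `n`. -/
def DimExpr.value (E : DimExpr) {n : ℕ} {M : Type u} [TopologicalSpace M]
    [ChartedSpace (Model n) M] [IsManifold (𝓡 (2 * n + 1)) ∞ M]
    {S : Pseudohermitian n M} {U : Set M} (F : AdmissibleFrame S U) (p : M) : ℂ :=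
  E.coeff n 0 * F.sublaplacian F.scal p + E.coeff n 1 * F.imDivDivA p
    + E.coeff n 2 * F.normSqA p + E.coeff n 3 * F.normSqSchoutenTF p
    + E.coeff n 4 * F.scal p ^ 2

/-- `E` has no pole at any dimension `n ≥ 1` (in particular none at `n = 1`) and computes
`4/(n-1)² P₄(1)` on all pseudo-Einstein manifolds of all CR dimensions `n ≥ 2`. -/
def DimExpr.RepresentsQPrime (E : DimExpr) : Prop :=
  (∀ k : ℕ, 1 ≤ k → E.den.eval (k : ℝ) ≠ 0) ∧
  ∀ (k : ℕ), 2 ≤ k → ∀ (N : Type u) [TopologicalSpace N] [ChartedSpace (Model k) N]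
    [IsManifold (𝓡 (2 * k + 1)) ∞ N] (S : Pseudohermitian k N), S.IsPseudoEinstein →
    ∀ (U : Set N) (F : AdmissibleFrame S U), ∀ p ∈ U,
      E.value F p = 4 / ((k : ℂ) - 1) ^ 2 * F.P4 (fun _ => 1) p

/-- `q` is the `Q'`-curvature over `U`.  For `n ≠ 1` this means `q = 4/(n-1)² P₄(1)`.  For `n = 1`
it means that `q` is the formal limit of that expression as `n → 1`, by continuation in the
dimension: `q` is the value at `n = 1` of an expression whose coefficients are rational in the
dimension without pole at `n = 1`, and which computes `4/(n-1)² P₄(1)` on all pseudo-Einstein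
manifolds of CR dimension `n ≥ 2`. -/
def AdmissibleFrame.IsQPrime {n : ℕ} {M : Type u} [TopologicalSpace M]
    [ChartedSpace (Model n) M] [IsManifold (𝓡 (2 * n + 1)) ∞ M]
    {S : Pseudohermitian n M} {U : Set M} (F : AdmissibleFrame S U) (q : M → ℂ) : Prop :=
  (n ≠ 1 → ∀ p ∈ U, q p = 4 / ((n : ℂ) - 1) ^ 2 * F.P4 (fun _ => 1) p) ∧
  (n = 1 → ∃ E : DimExpr, DimExpr.RepresentsQPrime.{u} E ∧ ∀ p ∈ U, q p = E.value F p)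

end CRGeometry

end

open scoped Manifold ContDiff

noncomputable section

namespace CRGeometry

universe u

/-! The operator `P₄` applied to the constant 1 leaves only its zeroth order term, so `4/(n-1)²
P₄(1) = 2/(n-1) Q₄`. For `n ≥ 2` the pseudo-Einstein condition makes `P̊` vanish, and what remains
is to trade the term `Im ∇^α∇^β A_{αβ}` for `Δ_b R`. This rests on the Schur-type identity `∇_α R =
i n ∇^β A_{αβ}` (`grad_scal`): since `R` is real, `Δ_b R = -2 Re ∇^α∇_α R`, hence `Δ_b R = 2n Im
∇^α∇^β A_{αβ}` (`sublaplacian_scal`). After the substitution every coefficient of `Q₄` contains the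
factor `n - 1`, which cancels the pole.

The identity comes from the closed 2-form `d ω_γ^γ`. The sum of `ω_γ^γ` and its conjugate is `d log
det h`, so `d ω_γ^γ` is imaginary (`ext_traceConn_conj`). Contracting the Jacobi identity of the
frame shows that its components on `(Z, Z)` and `(Z̄, Z̄)` vanish (`ext_traceConn_zb_zb`) and that
its component on `(Z_α, T)` is `∇^β A_{αβ}` (`ext_traceConn_z_t`); the component on `(Z_α, Z_β̄)` is
the Ricci tensor. If Ricci equals `f h`, then `d² = 0` on `(Z_α, Z_β, Z_γ̄)` says that `(∇_α f - i
∇^σ A_{ασ}) h_{βγ̄}` is symmetric in `α, β`. When `n ≥ 2`, contracting with some `β ≠ α` forces `∇_α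
f = i ∇^σ A_{ασ}` (`E_eq_divTorsion_of_ricci_eq`), and `f = R/n` gives the claim.

All of this is pure algebra in a commutative ring with conjugation and a frame of derivations: it
needs only the commutators, the Jacobi identity, integrability, `T ⌟ dθ = 0` and an invertible Levi
form. The geometric half of the proof shows that the smooth functions on `U` form such a ring
(`structureFunctions`).

For `n = 1` the `Q'`-curvature is defined by continuation in the dimension. The formula obtained for
`n ≥ 2` has coefficients rational in `n` with denominator `n²`, so `qPrimeExpr` is an admissible
expression and is evaluated at `n = 1`. -/

/-! ### Frames of derivations and the exterior derivative -/

/-- Functions `c i j k` with `[E i, E j] = ∑ k, c i j k E k` for a frame `E` of derivations,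
satisfying the Jacobi identity. -/
structure StructureFunctions (ι : Type*) [Fintype ι] (A : Type*) [CommRing A] where
  /-- the frame -/
  E : ι → Derivation ℤ A A
  /-- the structure functions -/
  c : ι → ι → ι → A
  c_self : ∀ i k, c i i k = 0
  antisymm : ∀ i j k, c i j k = -c j i k
  comm : ∀ i j f, E i (E j f) - E j (E i f) = ∑ k, c i j k * E k f
  jacobi : ∀ i j k l, E i (c j k l) + E j (c k i l) + E k (c i j l)
    + ∑ m, (c j k m * c i m l + c k i m * c j m l + c i j m * c k m l) = 0

namespace StructureFunctions

variable {ι : Type*} [Fintype ι] {A : Type*} [CommRing A] (S : StructureFunctions ι A)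

/-- The exterior derivative of the `1`-form with components `w`. -/
def ext (w : ι → A) (i j : ι) : A :=
  S.E i (w j) - S.E j (w i) - ∑ k, S.c i j k * w k

theorem ext_swap (w : ι → A) (i j : ι) : S.ext w i j = -S.ext w j i := by
  simp only [ext, S.antisymm i j, neg_mul, Finset.sum_neg_distrib]
  ring

/-- This is `d(dw) = 0` on three frame fields, the source of the Bianchi identity below. Second
derivatives of `w` combine by `comm`; the terms linear in `w` itself cancel by the Jacobi identity
contracted with `w`. -/
theorem ext_ext (w : ι → A) (i j k : ι) :
    S.E i (S.ext w j k) + S.E j (S.ext w k i) + S.E k (S.ext w i j)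
      = ∑ m, (S.c i j m * S.ext w m k + S.c j k m * S.ext w m i + S.c k i m * S.ext w m j) := by
  have hJ : ∑ l, (S.E i (S.c j k l) + S.E j (S.c k i l) + S.E k (S.c i j l)
    + ∑ m, (S.c j k m * S.c i m l + S.c k i m * S.c j m l + S.c i j m * S.c k m l)) * w l = 0 :=
    Finset.sum_eq_zero fun l _ => by rw [S.jacobi, zero_mul]
  have h1 := S.comm i j (w k)
  have h2 := S.comm j k (w i)
  have h3 := S.comm k i (w j)
  -- The bracket terms of `d(dw)`, with antisymmetry used to bring the quadratic terms into the
  -- shape in which they occur in `hJ`.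
  have hsum : ∀ a b d : ι, ∑ m, S.c a b m * S.ext w m d
      = ∑ m, S.c a b m * S.E m (w d) - ∑ m, S.c a b m * S.E d (w m)
        + ∑ l, (∑ m, S.c a b m * S.c d m l) * w l := by
    intro a b d
    simp only [ext, Finset.sum_mul]
    rw [Finset.sum_comm (γ := ι), ← Finset.sum_sub_distrib, ← Finset.sum_add_distrib]
    refine Finset.sum_congr rfl fun m _ => ?_
    have : ∑ x, S.c a b m * S.c d m x * w x = -(S.c a b m * ∑ x, S.c m d x * w x) := by
      rw [Finset.mul_sum, ← Finset.sum_neg_distrib]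
      exact Finset.sum_congr rfl fun x _ => by rw [S.antisymm d m x]; ring
    rw [this]; ring
  simp only [Finset.sum_add_distrib, hsum]
  simp only [Finset.sum_add_distrib, add_mul] at hJ
  simp only [ext, map_sub, map_sum, Derivation.leibniz, smul_eq_mul, Finset.sum_add_distrib]
  have hc : ∀ a b d : ι, ∑ x, w x * S.E d (S.c a b x) = ∑ x, S.E d (S.c a b x) * w x :=
    fun a b d => Finset.sum_congr rfl fun _ _ => mul_comm _ _
  simp only [hc]
  linear_combination h1 + h2 + h3 - hJ

end StructureFunctions

/-! ### Structure functions of a pseudohermitian frame -/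

/-- Indices of the frame `T, Z_α, Z_{ᾱ}`. -/
abbrev FrameIndex (n : ℕ) : Type := Unit ⊕ (Fin n ⊕ Fin n)

namespace FrameIndex

variable {n : ℕ}

/-- The index of `T`. -/
abbrev t : FrameIndex n := Sum.inl ()

/-- The index of `Z_α`. -/
abbrev z (α : Fin n) : FrameIndex n := Sum.inr (Sum.inl α)

/-- The index of `Z_{ᾱ}`. -/
abbrev zb (α : Fin n) : FrameIndex n := Sum.inr (Sum.inr α)

/-- Conjugation of indices. -/
def bar : FrameIndex n → FrameIndex n := Sum.map id Sum.swap

@[simp] theorem bar_t : bar (t : FrameIndex n) = t := rfl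
@[simp] theorem bar_z (α : Fin n) : bar (z α) = zb α := rfl
@[simp] theorem bar_zb (α : Fin n) : bar (zb α) = z α := rfl

@[simp] theorem bar_bar (i : FrameIndex n) : bar (bar i) = i := by
  rcases i with _ | _ | _ <;> rfl

theorem sum_bar {A : Type*} [AddCommMonoid A] (f : FrameIndex n → A) :
    ∑ i, f (bar i) = ∑ i, f i :=
  Fintype.sum_equiv ⟨bar, bar, bar_bar, bar_bar⟩ _ _ fun _ => rfl

theorem sum_eq {A : Type*} [AddCommMonoid A] (f : FrameIndex n → A) :
    ∑ i, f i = f t + (∑ a, f (z a) + ∑ a, f (zb a)) := by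
  simp [Fintype.sum_sum_type]

end FrameIndex

open FrameIndex

/-- Structure functions of an admissible frame of a pseudohermitian manifold, in a ring with
conjugation and an imaginary unit. -/
structure CRStructureFunctions (n : ℕ) (A : Type*) [CommRing A] extends
    StructureFunctions (FrameIndex n) A where
  /-- conjugation -/
  conj : A →+* A
  /-- the imaginary unit -/
  I : A
  /-- the inverse of the Levi form -/
  hInv : Fin n → Fin n → A
  conj_conj : ∀ f, conj (conj f) = f
  I_mul_I : I * I = -1
  conj_I : conj I = -I
  E_I : ∀ i, E i I = 0
  E_conj : ∀ i f, E (bar i) (conj f) = conj (E i f)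
  c_conj : ∀ i j k, c (bar i) (bar j) (bar k) = conj (c i j k)
  -- The next two fields express `[T^{1,0}, T^{1,0}] ⊆ T^{1,0}`; the one after them expresses `T ⌟
  -- dθ = 0`.
  c_z_z_t : ∀ a b, c (z a) (z b) t = 0
  c_z_z_zb : ∀ a b d, c (z a) (z b) (zb d) = 0
  c_t_t : ∀ i, c t i t = 0
  sum_hInv_mul : ∀ a g, ∑ b, hInv a b * (I * c (z g) (zb b) t) = if a = g then 1 else 0

namespace CRStructureFunctions

variable {n : ℕ} {A : Type*} [CommRing A] (S : CRStructureFunctions n A)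

/-- The Levi form `h_{αβ̄}`. -/
def h (a b : Fin n) : A := S.I * S.c (z a) (zb b) t

/-- `ω_α^β(Z_{γ̄})` -/
def connBar (g a b : Fin n) : A := S.c (zb g) (z a) (z b)

/-- `ω_α^β(T)` -/
def connReeb (a b : Fin n) : A := S.c t (z a) (z b)

/-- `ω_α^β(Z_γ)` -/
def connHol (g a b : Fin n) : A :=
  ∑ s, S.hInv b s * (S.E (z g) (S.h a s) - S.conj (∑ m, S.h m a * S.connBar g s m))

/-- The torsion `A_{αβ}`. -/
def torsion (a b : Fin n) : A := S.conj (∑ g, S.h g a * -S.c t (zb b) (z g))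

/-- The divergence `∇^β A_{αβ}` of the torsion. -/
def divTorsion (a : Fin n) : A :=
  ∑ b, ∑ g, S.hInv b g * (S.E (zb g) (S.torsion a b) - ∑ s, S.connBar g a s * S.torsion s b
    - ∑ s, S.connBar g b s * S.torsion a s)

/-- The components of the trace `ω_α^α` of the connection form. -/
def traceConn : FrameIndex n → A :=
  Sum.elim (fun _ => ∑ a, S.connReeb a a)
    (Sum.elim (fun g => ∑ a, S.connHol g a a) (fun g => ∑ a, S.connBar g a a))

/-- The Ricci tensor. -/
def ricci (a b : Fin n) : A := S.ext S.traceConn (z a) (zb b)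

/-- The scalar curvature. -/
def scal : A := ∑ a, ∑ b, S.hInv a b * S.ricci a b

@[simp] theorem traceConn_t : S.traceConn t = ∑ a, S.connReeb a a := rfl
@[simp] theorem traceConn_z (g : Fin n) : S.traceConn (z g) = ∑ a, S.connHol g a a := rfl
@[simp] theorem traceConn_zb (g : Fin n) : S.traceConn (zb g) = ∑ a, S.connBar g a a := rfl

theorem E_bar (i : FrameIndex n) (f : A) : S.E (bar i) f = S.conj (S.E i (S.conj f)) := by
  rw [← S.E_conj, S.conj_conj]

theorem E_zb (a : Fin n) (f : A) : S.E (zb a) f = S.conj (S.E (z a) (S.conj f)) :=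
  S.E_bar (z a) f

/-! ### The brackets sorted by type -/

theorem c_i_t_t (i : FrameIndex n) : S.c i t t = 0 := by rw [S.antisymm, S.c_t_t, neg_zero]

theorem c_zb_zb_t (a b : Fin n) : S.c (zb a) (zb b) t = 0 := by
  have := S.c_conj (z a) (z b) t
  simpa [S.c_z_z_t] using this

theorem c_zb_zb_z (a b d : Fin n) : S.c (zb a) (zb b) (z d) = 0 := by
  have := S.c_conj (z a) (z b) (zb d)
  simpa [S.c_z_z_zb] using this

theorem c_z_zb_t (a b : Fin n) : S.c (z a) (zb b) t = -(S.I * S.h a b) := by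
  rw [h, ← mul_assoc, S.I_mul_I]; ring

theorem c_zb_z_t (a b : Fin n) : S.c (zb b) (z a) t = S.I * S.h a b := by
  rw [S.antisymm, c_z_zb_t, neg_neg]

theorem c_z_zb_z (g a b : Fin n) : S.c (z a) (zb g) (z b) = -S.connBar g a b := by
  rw [S.antisymm, connBar]

theorem c_z_zb_zb (g a b : Fin n) : S.c (z g) (zb a) (zb b) = S.conj (S.connBar g a b) := by
  exact S.c_conj (zb g) (z a) (z b)

theorem c_zb_z_zb (g a b : Fin n) : S.c (zb a) (z g) (zb b) = -S.conj (S.connBar g a b) := by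
  rw [S.antisymm, c_z_zb_zb]

theorem c_t_zb_zb (a b : Fin n) : S.c t (zb a) (zb b) = S.conj (S.connReeb a b) := by
  exact S.c_conj t (z a) (z b)

theorem c_zb_t_zb (a b : Fin n) : S.c (zb a) t (zb b) = -S.conj (S.connReeb a b) := by
  rw [S.antisymm, c_t_zb_zb]

theorem c_zb_t_z (a b : Fin n) : S.c (zb a) t (z b) = -S.c t (zb a) (z b) := S.antisymm _ _ _

/-! ### The Levi form and its inverse -/

theorem conj_h (a b : Fin n) : S.conj (S.h a b) = S.h b a := by
  have := S.c_conj (z a) (zb b) t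
  simp only [bar_z, bar_zb, bar_t] at this
  rw [h, map_mul, ← this, S.conj_I, S.antisymm, h]; ring

theorem sum_hInv_h (a g : Fin n) : ∑ b, S.hInv a b * S.h g b = if a = g then 1 else 0 :=
  S.sum_hInv_mul a g

/-- The matrix of the Levi form. -/
def hMat : Matrix (Fin n) (Fin n) A := Matrix.of S.h

/-- The inverse of the matrix of the Levi form. -/
def hInvMat : Matrix (Fin n) (Fin n) A := Matrix.of fun b a => S.hInv a b

/-- The indices of `hInv` are swapped in `hInvMat`, so that the contraction over barred indices in
`sum_hInv_mul` becomes a matrix product. Over a commutative ring the one-sided inverse is two-sided,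
which then allows contraction over unbarred indices as well. -/
theorem hMat_mul_hInvMat : S.hMat * S.hInvMat = 1 := by
  ext g a
  rw [Matrix.mul_apply, Matrix.one_apply]
  simp only [hMat, hInvMat, Matrix.of_apply]
  rw [← (by rw [sum_hInv_h]; simp [eq_comm] :
    ∑ b, S.hInv a b * S.h g b = if g = a then 1 else 0)]
  exact Finset.sum_congr rfl fun _ _ => mul_comm _ _

theorem hInvMat_mul_hMat : S.hInvMat * S.hMat = 1 :=
  mul_eq_one_comm.mp S.hMat_mul_hInvMat

theorem sum_hInv_h' (b g : Fin n) : ∑ a, S.hInv a b * S.h a g = if b = g then 1 else 0 := by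
  have := congrFun (congrFun S.hInvMat_mul_hMat b) g
  rwa [Matrix.mul_apply, Matrix.one_apply] at this

/-- The conjugate transpose of `h⁻¹` is a left inverse of `h`, because `h` is hermitian; left and
right inverses agree. -/
theorem conj_hInv (a b : Fin n) : S.conj (S.hInv a b) = S.hInv b a := by
  have hT : (S.hInvMat.map S.conj).transpose * S.hMat = 1 := by
    have := congrArg (fun M : Matrix (Fin n) (Fin n) A => (M.map S.conj).transpose)
        S.hMat_mul_hInvMat
    simp only [Matrix.map_mul, Matrix.transpose_mul] at this
    have hh : (S.hMat.map S.conj).transpose = S.hMat := by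
      ext i j; simp [hMat, conj_h]
    rw [hh] at this
    rw [this]
    ext i j
    simp [Matrix.one_apply, eq_comm]
  have := congrArg (· * S.hInvMat) hT
  simp only [Matrix.mul_assoc, S.hMat_mul_hInvMat, Matrix.mul_one, Matrix.one_mul] at this
  exact congrFun (congrFun this a) b

/-- Cancelling the Levi form: raising an index and lowering it again. -/
theorem sum_hInv_sum_h (b : Fin n) (f : Fin n → A) :
    ∑ a, S.hInv a b * ∑ g, S.h a g * f g = f b := by
  simp only [Finset.mul_sum]
  rw [Finset.sum_comm]
  simp only [← mul_assoc, ← Finset.sum_mul, sum_hInv_h']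
  simp

theorem sum_hInv_sum_h' (a : Fin n) (f : Fin n → A) :
    ∑ b, S.hInv a b * ∑ g, S.h g b * f g = f a := by
  simp only [Finset.mul_sum]
  rw [Finset.sum_comm]
  simp only [← mul_assoc, ← Finset.sum_mul, sum_hInv_h]
  simp

/-! ### Consequences of the Jacobi identity -/

theorem I_mul_cancel {x y : A} (hxy : S.I * x = S.I * y) : x = y := by
  have := congrArg (S.I * ·) hxy
  simp only [← mul_assoc, S.I_mul_I] at this
  linear_combination -this

/-- This is the `θ`-component of the Jacobi identity for `T, Z_ā, Z_b̄`, that is, `d(dθ) = 0` on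
these fields. It is the reason why the torsion is symmetric. -/
theorem sum_h_torsion_symm (a b : Fin n) :
    ∑ m, S.h m a * S.c t (zb b) (z m) = ∑ m, S.h m b * S.c t (zb a) (z m) := by
  have := S.jacobi t (zb a) (zb b) t
  rw [sum_eq] at this
  simp only [c_zb_zb_t, c_t_t, c_i_t_t, c_zb_zb_z, c_zb_t_z, c_zb_z_t, map_zero,
    mul_zero, zero_add, add_zero, Finset.sum_const_zero] at this
  apply S.I_mul_cancel
  simp only [Finset.sum_add_distrib] at this
  simp only [Finset.mul_sum]
  have e : ∀ x y : Fin n, ∑ m, -S.c t (zb x) (z m) * (S.I * S.h m y)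
      = -∑ m, S.I * (S.h m y * S.c t (zb x) (z m)) := fun x y => by
    rw [← Finset.sum_neg_distrib]; exact Finset.sum_congr rfl fun _ _ => by ring
  have e' : ∀ x y : Fin n, ∑ m, S.c t (zb x) (z m) * (S.I * S.h m y)
      = ∑ m, S.I * (S.h m y * S.c t (zb x) (z m)) := fun x y =>
    Finset.sum_congr rfl fun _ _ => by ring
  rw [e, e'] at this
  linear_combination -this

theorem torsion_symm (a b : Fin n) : S.torsion a b = S.torsion b a := by
  simp only [torsion, mul_neg, Finset.sum_neg_distrib, sum_h_torsion_symm]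

/-- The `θ`-component of the Jacobi identity for `T, Z_a, Z_b̄`. It is Webster's relation `ω_{ab̄} +
ω_{b̄a} = dh_{ab̄}` in the direction `T`, where it is not built into the definition of `connReeb`.
-/
theorem E_t_h (a b : Fin n) :
    S.E t (S.h a b) = ∑ m, S.h a m * S.conj (S.connReeb b m) + ∑ m, S.h m b * S.connReeb a m := by
  have := S.jacobi t (z a) (zb b) t
  rw [sum_eq] at this
  simp only [c_zb_zb_t, c_t_t, c_i_t_t, c_zb_t_zb, c_zb_z_t, c_z_z_t, c_z_zb_t, map_zero,
    mul_zero, zero_add, add_zero, map_neg, Derivation.leibniz, S.E_I, smul_eq_mul] at this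
  apply S.I_mul_cancel
  simp only [mul_add, Finset.mul_sum]
  have e2 : ∑ m, -S.conj (S.connReeb b m) * -(S.I * S.h a m)
      = ∑ m, S.I * (S.h a m * S.conj (S.connReeb b m)) :=
    Finset.sum_congr rfl fun _ _ => by ring
  have e3 : ∑ m, S.c t (z a) (z m) * (S.I * S.h m b)
      = ∑ m, S.I * (S.h m b * S.connReeb a m) :=
    Finset.sum_congr rfl fun _ _ => by rw [connReeb]; ring
  simp only [e2, e3] at this
  linear_combination -this

/-- The `θ`-component of the Jacobi identity for `Z_g, Z_a, Z_b̄`. The left side is `ω_{ab̄}(Z_g) -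
ω_{gb̄}(Z_a)`, so raising `b` yields the vanishing of the torsion on `T^{1,0}`. -/
theorem E_z_h (g a b : Fin n) :
    S.E (z g) (S.h a b) - ∑ m, S.h a m * S.conj (S.connBar g b m)
      - (S.E (z a) (S.h g b) - ∑ m, S.h g m * S.conj (S.connBar a b m))
      = ∑ m, S.h m b * S.c (z g) (z a) (z m) := by
  have := S.jacobi (z g) (z a) (zb b) t
  rw [sum_eq] at this
  simp only [c_zb_zb_t, c_i_t_t, c_zb_z_t, c_z_z_t, c_z_zb_t, map_zero, c_z_z_zb,
    c_zb_z_zb, c_z_zb_zb,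
    mul_zero, zero_add, add_zero, map_neg, Derivation.leibniz, S.E_I, smul_eq_mul,
    Finset.sum_add_distrib] at this
  apply S.I_mul_cancel
  have e1 : ∑ m, S.conj (S.connBar a b m) * -(S.I * S.h g m)
      = -(S.I * ∑ m, S.h g m * S.conj (S.connBar a b m)) := by
    rw [Finset.mul_sum, ← Finset.sum_neg_distrib]
    exact Finset.sum_congr rfl fun _ _ => by ring
  have e2 : ∑ m, -S.conj (S.connBar g b m) * -(S.I * S.h a m)
      = S.I * ∑ m, S.h a m * S.conj (S.connBar g b m) := by
    rw [Finset.mul_sum]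
    exact Finset.sum_congr rfl fun _ _ => by ring
  have e3 : ∑ m, S.c (z g) (z a) (z m) * (S.I * S.h m b)
      = S.I * ∑ m, S.h m b * S.c (z g) (z a) (z m) := by
    rw [Finset.mul_sum]
    exact Finset.sum_congr rfl fun _ _ => by ring
  simp only [e1, e2, e3] at this
  linear_combination -this

theorem connHol_eq (g a b : Fin n) : S.connHol g a b =
    ∑ s, S.hInv b s * (S.E (z g) (S.h a s) - ∑ m, S.h a m * S.conj (S.connBar g s m)) := by
  simp only [connHol, map_sum, map_mul, conj_h]

/-- The connection has no torsion on `T^{1,0}`. -/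
theorem connHol_sub_connHol (g a b : Fin n) :
    S.connHol g a b - S.connHol a g b = S.c (z g) (z a) (z b) := by
  rw [connHol_eq, connHol_eq, ← Finset.sum_sub_distrib]
  simp only [← mul_sub, E_z_h]
  rw [sum_hInv_sum_h']

end CRStructureFunctions

open FrameIndex

namespace CRStructureFunctions

variable {n : ℕ} {A : Type*} [CommRing A] (S : CRStructureFunctions n A)

/-! ### The trace of the connection form -/

/-- The logarithmic differential of the determinant of the Levi form. -/
def logDet (i : FrameIndex n) : A := ∑ a, ∑ b, S.hInv a b * S.E i (S.h a b)

theorem conj_logDet (i : FrameIndex n) : S.conj (S.logDet i) = S.logDet (bar i) := by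
  simp only [logDet, map_sum, map_mul, conj_hInv, ← S.E_conj, conj_h]
  exact Finset.sum_comm

/-- The trace of `ω_{ab̄} + ω_{b̄a} = dh_{ab̄}`. In the directions `Z` it is the definition of
`connHol`, along `T` it is `E_t_h`, and the directions `Z̄` follow by conjugation. -/
theorem traceConn_add_conj (i : FrameIndex n) :
    S.traceConn i + S.conj (S.traceConn (bar i)) = S.logDet i := by
  have hz : ∀ g, S.traceConn (z g) + S.conj (S.traceConn (zb g)) = S.logDet (z g) := by
    intro g
    simp only [traceConn_z, traceConn_zb, connHol_eq, mul_sub, Finset.sum_sub_distrib, logDet]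
    rw [Finset.sum_comm (f := fun a s => S.hInv a s * ∑ m, S.h a m * S.conj (S.connBar g s m))]
    simp only [sum_hInv_sum_h, map_sum]
    ring
  rcases i with ⟨⟨⟩⟩ | a | a
  · simp only [bar_t, traceConn_t, logDet, E_t_h, mul_add, Finset.sum_add_distrib, map_sum]
    rw [Finset.sum_comm (f := fun a b => S.hInv a b * ∑ m, S.h a m * S.conj (S.connReeb b m))]
    simp only [sum_hInv_sum_h, sum_hInv_sum_h']
    ring
  · exact hz a
  · have := congrArg S.conj (hz a)
    rw [conj_logDet, map_add, S.conj_conj] at this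
    rw [bar_zb, add_comm]
    exact this

/-- Differentiate `h⁻¹ h = 1`. -/
theorem map_E_hInvMat (i : FrameIndex n) :
    S.hInvMat.map (S.E i) = -(S.hInvMat * S.hMat.map (S.E i) * S.hInvMat) := by
  have h0 : S.hInvMat.map (S.E i) * S.hMat + S.hInvMat * S.hMat.map (S.E i) = 0 := by
    ext a b
    have := congrArg (S.E i) (congrFun (congrFun S.hInvMat_mul_hMat a) b)
    simp only [Matrix.mul_apply, map_sum, Derivation.leibniz, smul_eq_mul, Matrix.one_apply,
      Finset.sum_add_distrib] at this
    simp only [Matrix.add_apply, Matrix.mul_apply, Matrix.map_apply, Matrix.zero_apply]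
    rw [apply_ite (S.E i), map_zero, Derivation.map_one_eq_zero, ite_self] at this
    rw [← this, add_comm]
    congr 1
    exact Finset.sum_congr rfl fun _ _ => mul_comm _ _
  have := congrArg (· * S.hInvMat) h0
  simp only [Matrix.add_mul, Matrix.mul_assoc, S.hMat_mul_hInvMat, Matrix.mul_one,
    Matrix.zero_mul] at this
  rw [Matrix.mul_assoc]
  exact eq_neg_of_add_eq_zero_left this

theorem E_logDet (i j : FrameIndex n) :
    S.E i (S.logDet j) =
      -(S.hInvMat * S.hMat.map (S.E i) * S.hInvMat * S.hMat.map (S.E j)).trace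
      + ∑ a, ∑ b, S.hInv a b * S.E i (S.E j (S.h a b)) := by
  rw [← Matrix.trace_neg, ← Matrix.neg_mul, ← map_E_hInvMat]
  simp only [logDet, map_sum, Derivation.leibniz, smul_eq_mul, Finset.sum_add_distrib,
    Matrix.trace, Matrix.diag, Matrix.mul_apply, hInvMat, hMat, Matrix.of_apply, Matrix.map_apply]
  rw [add_comm]
  congr 1
  rw [Finset.sum_comm]
  exact Finset.sum_congr rfl fun _ _ => Finset.sum_congr rfl fun _ _ => mul_comm _ _

/-- Formally this is `d(d log det h) = 0`, proved without a logarithm. In `E_i (logDet j)` the term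
quadratic in first derivatives of `h` is symmetric in `i, j` because the trace is cyclic, and the
second derivatives of `h` differ by the commutator. -/
theorem ext_logDet (i j : FrameIndex n) : S.ext S.logDet i j = 0 := by
  have ht : (S.hInvMat * S.hMat.map (S.E i) * S.hInvMat * S.hMat.map (S.E j)).trace
      = (S.hInvMat * S.hMat.map (S.E j) * S.hInvMat * S.hMat.map (S.E i)).trace := by
    rw [Matrix.mul_assoc, Matrix.trace_mul_comm, ← Matrix.mul_assoc]
  have hs : ∑ a, ∑ b, S.hInv a b * S.E i (S.E j (S.h a b))
      - ∑ a, ∑ b, S.hInv a b * S.E j (S.E i (S.h a b)) = ∑ k, S.c i j k * S.logDet k := by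
    simp only [← Finset.sum_sub_distrib, ← mul_sub, S.comm, logDet, Finset.mul_sum]
    rw [Finset.sum_comm (s := (Finset.univ : Finset (FrameIndex n)))]
    refine Finset.sum_congr rfl fun a _ => ?_
    rw [Finset.sum_comm]
    exact Finset.sum_congr rfl fun _ _ => Finset.sum_congr rfl fun _ _ => by ring
  rw [StructureFunctions.ext, E_logDet, E_logDet, ht, ← hs]
  ring

theorem conj_ext (w : FrameIndex n → A) (i j : FrameIndex n) :
    S.conj (S.ext w (bar i) (bar j)) = S.ext (fun k => S.conj (w (bar k))) i j := by
  simp only [StructureFunctions.ext, map_sub, map_sum, map_mul]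
  rw [← S.E_conj, ← S.E_conj, bar_bar, bar_bar]
  congr 1
  rw [← sum_bar]
  exact Finset.sum_congr rfl fun k _ => by rw [← S.c_conj]; simp

/-- The trace of the curvature form is imaginary. -/
theorem ext_traceConn_conj (i j : FrameIndex n) :
    S.ext S.traceConn i j = -S.conj (S.ext S.traceConn (bar i) (bar j)) := by
  -- Closedness of the sum of `ω_γ^γ` and its conjugate; `ext` is additive in the form.
  have h0 := S.ext_logDet i j
  have hw : S.logDet = fun k => S.traceConn k + S.conj (S.traceConn (bar k)) :=
    funext fun k => (S.traceConn_add_conj k).symm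
  rw [hw] at h0
  rw [conj_ext]
  simp only [StructureFunctions.ext, map_add, mul_add, Finset.sum_add_distrib] at h0 ⊢
  linear_combination h0

theorem conj_ricci (a b : Fin n) : S.conj (S.ricci a b) = S.ricci b a := by
  rw [ricci, ricci, S.ext_swap, S.ext_traceConn_conj]
  simp [S.conj_conj]

theorem conj_scal : S.conj S.scal = S.scal := by
  simp only [scal, map_sum, map_mul, conj_ricci, conj_hInv]
  exact Finset.sum_comm

/-! ### Components of the trace of the curvature form -/

theorem sum_mul_comm_trace (f g : Fin n → Fin n → A) :
    ∑ a, ∑ e, f a e * g e a = ∑ a, ∑ e, g a e * f e a := by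
  rw [Finset.sum_comm]
  exact Finset.sum_congr rfl fun _ _ => Finset.sum_congr rfl fun _ _ => mul_comm _ _

theorem c_zb_z_z (g a b : Fin n) : S.c (zb g) (z a) (z b) = S.connBar g a b := rfl

theorem c_t_z_z (a b : Fin n) : S.c t (z a) (z b) = S.connReeb a b := rfl

/-- Take the `Z_a`-component of the Jacobi identity for `Z_ḡ, Z_d̄, Z_a` and sum over `a`. The
quadratic connection terms cancel as the trace of a commutator, and the two torsion terms cancel by
`sum_h_torsion_symm`. -/
theorem ext_traceConn_zb_zb (g d : Fin n) : S.ext S.traceConn (zb g) (zb d) = 0 := by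
  have hsum := Finset.sum_eq_zero (s := Finset.univ) fun a _ =>
    S.jacobi (zb g) (zb d) (z a) (z a)
  simp only [sum_eq, c_zb_zb_z, c_zb_zb_t, c_zb_t_z, c_zb_z_t, c_z_zb_z, c_zb_z_z, c_z_zb_t,
    map_zero,
    Finset.sum_const_zero,
    zero_mul, mul_zero, zero_add, add_zero, map_neg, Finset.sum_add_distrib, neg_mul, mul_neg,
    neg_neg, Finset.sum_neg_distrib, mul_assoc, ← Finset.mul_sum, S.sum_h_torsion_symm g d] at hsum
  have hcomm := sum_mul_comm_trace (S.connBar g) (S.connBar d)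
  have hc : ∑ a, ∑ e, S.c (zb g) (zb d) (zb e) * S.connBar e a a
      = ∑ e, S.c (zb g) (zb d) (zb e) * ∑ a, S.connBar e a a := by
    simp only [Finset.mul_sum]
    exact Finset.sum_comm
  simp only [StructureFunctions.ext, sum_eq, c_zb_zb_t, c_zb_zb_z, traceConn_zb, map_sum,
    Finset.sum_const_zero, zero_mul, zero_add]
  linear_combination hsum + hcomm + hc

theorem ext_traceConn_z_z (g d : Fin n) : S.ext S.traceConn (z g) (z d) = 0 := by
  rw [ext_traceConn_conj, bar_z, bar_z, ext_traceConn_zb_zb, map_zero, neg_zero]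

/-- The same contraction of the Jacobi identity, now for `Z_ḡ, T, Z_a`. The right side is a
covariant divergence of the torsion component `c t (zb g) (z a)`. -/
theorem ext_traceConn_zb_t (g : Fin n) : S.ext S.traceConn (zb g) t =
    ∑ a, (S.E (z a) (S.c t (zb g) (z a)) + ∑ e, S.connHol a e a * S.c t (zb g) (z e)
      - ∑ e, S.conj (S.connBar a g e) * S.c t (zb e) (z a)) := by
  have hsum := Finset.sum_eq_zero (s := Finset.univ) fun a _ => S.jacobi (zb g) t (z a) (z a)
  simp only [sum_eq, S.c_self, c_zb_zb_z, c_zb_t_z, c_z_zb_z, c_zb_z_z, c_t_z_z, c_t_t, c_i_t_t,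
    c_z_zb_zb, c_zb_t_zb,
    zero_mul, mul_zero, zero_add, add_zero, map_neg, Finset.sum_add_distrib, neg_mul, mul_neg,
    neg_neg, Finset.sum_neg_distrib, Finset.sum_const_zero] at hsum
  have hcomm := sum_mul_comm_trace (S.connBar g) S.connReeb
  have hc : ∑ a, ∑ e, S.conj (S.connReeb g e) * S.connBar e a a
      = ∑ e, S.conj (S.connReeb g e) * ∑ a, S.connBar e a a := by
    simp only [Finset.mul_sum]
    exact Finset.sum_comm
  -- The bracket `[Z_a, Z_e]` is replaced by `ω_e^a(Z_a) - ω_a^a(Z_e)`, by vanishing torsion on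
  -- `T^{1,0}`; its second part is absorbed by the trace of the connection.
  have ht : ∑ a, ∑ e, S.c t (zb g) (z e) * S.c (z a) (z e) (z a)
      = ∑ a, ∑ e, S.connHol a e a * S.c t (zb g) (z e)
        - ∑ e, S.c t (zb g) (z e) * ∑ a, S.connHol e a a := by
    simp only [Finset.mul_sum]
    rw [Finset.sum_comm (f := fun e a => S.c t (zb g) (z e) * S.connHol e a a),
      ← Finset.sum_sub_distrib]
    refine Finset.sum_congr rfl fun a _ => ?_
    rw [← Finset.sum_sub_distrib]
    exact Finset.sum_congr rfl fun e _ => by rw [← connHol_sub_connHol]; ring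
  simp only [StructureFunctions.ext, sum_eq, c_zb_t_zb, c_zb_t_z, c_i_t_t, traceConn_zb,
    traceConn_z, traceConn_t, map_sum, zero_mul, zero_add, neg_mul,
    Finset.sum_neg_distrib, Finset.sum_add_distrib, Finset.sum_sub_distrib]
  linear_combination hsum + hcomm - hc + ht

theorem torsion_eq (a b : Fin n) :
    S.torsion a b = -∑ d, S.h b d * S.conj (S.c t (zb a) (z d)) := by
  rw [torsion_symm, torsion]
  simp only [mul_neg, Finset.sum_neg_distrib, map_neg, map_sum, map_mul, conj_h]

theorem conj_connHol (g a b : Fin n) : S.conj (S.connHol g a b) =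
    ∑ s, S.hInv s b * (S.E (zb g) (S.h s a) - ∑ m, S.h m a * S.connBar g s m) := by
  simp only [connHol_eq, map_sum, map_mul, map_sub, conj_hInv, conj_h, S.conj_conj, E_zb]

/-- Lowering an index commutes with covariant differentiation, since the connection is metric.
Writing `A_{ab}` as a lowered torsion component, the derivatives of `h` combine with `connBar` into
conjugates of `connHol`, and `h` cancels against its inverse. The result is visibly conjugate to
`ext_traceConn_zb_t`. -/
theorem divTorsion_eq (a : Fin n) :
    S.divTorsion a = -∑ b, (S.E (zb b) (S.conj (S.c t (zb a) (z b)))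
      + ∑ e, S.conj (S.connHol b e b) * S.conj (S.c t (zb a) (z e))
      - ∑ e, S.connBar b a e * S.conj (S.c t (zb e) (z b))) := by
  -- Product rule for `A_{ab} = -∑ h_{bd̄} · (torsion)^{d̄}_a`: one part differentiates the torsion
  -- component, the other is what becomes the connection on barred indices.
  have key : ∀ b g, S.E (zb g) (S.torsion a b) - ∑ s, S.connBar g a s * S.torsion s b
      - ∑ s, S.connBar g b s * S.torsion a s =
      -(∑ d, S.h b d * (S.E (zb g) (S.conj (S.c t (zb a) (z d)))
          - ∑ s, S.connBar g a s * S.conj (S.c t (zb s) (z d)))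
        + ∑ d, (S.E (zb g) (S.h b d) - ∑ s, S.h s d * S.connBar g b s)
          * S.conj (S.c t (zb a) (z d))) := by
    intro b g
    have e1 : ∑ d, S.h b d * ∑ s, S.connBar g a s * S.conj (S.c t (zb s) (z d))
        = ∑ s, S.connBar g a s * ∑ d, S.h b d * S.conj (S.c t (zb s) (z d)) := by
      simp only [Finset.mul_sum]
      rw [Finset.sum_comm]
      exact Finset.sum_congr rfl fun _ _ => Finset.sum_congr rfl fun _ _ => by ring
    have e2 : ∑ d, (∑ s, S.h s d * S.connBar g b s) * S.conj (S.c t (zb a) (z d))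
        = ∑ s, S.connBar g b s * ∑ d, S.h s d * S.conj (S.c t (zb a) (z d)) := by
      simp only [Finset.mul_sum, Finset.sum_mul]
      rw [Finset.sum_comm]
      exact Finset.sum_congr rfl fun _ _ => Finset.sum_congr rfl fun _ _ => by ring
    have e3 : ∑ d, S.E (zb g) (S.h b d) * S.conj (S.c t (zb a) (z d))
        = ∑ d, S.conj (S.c t (zb a) (z d)) * S.E (zb g) (S.h b d) :=
      Finset.sum_congr rfl fun _ _ => mul_comm _ _
    simp only [torsion_eq, map_neg, map_sum, Derivation.leibniz, smul_eq_mul, mul_sub, sub_mul,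
      Finset.sum_sub_distrib, Finset.sum_add_distrib, mul_neg, Finset.sum_neg_distrib, e1, e2, e3]
    ring
  simp only [divTorsion, key, mul_neg, mul_add, Finset.sum_neg_distrib, Finset.sum_add_distrib]
  rw [Finset.sum_comm, Finset.sum_comm (f := fun b g => S.hInv b g *
    ∑ d, (S.E (zb g) (S.h b d) - ∑ s, S.h s d * S.connBar g b s) * S.conj (S.c t (zb a) (z d)))]
  have e4 : ∀ g, ∑ b, S.hInv b g * ∑ d, (S.E (zb g) (S.h b d) - ∑ s, S.h s d * S.connBar g b s)
      * S.conj (S.c t (zb a) (z d))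
      = ∑ e, S.conj (S.connHol g e g) * S.conj (S.c t (zb a) (z e)) := by
    intro g
    simp only [conj_connHol, Finset.mul_sum, Finset.sum_mul]
    rw [Finset.sum_comm]
    exact Finset.sum_congr rfl fun _ _ => Finset.sum_congr rfl fun _ _ => by ring
  simp only [sum_hInv_sum_h, e4, Finset.sum_sub_distrib, Finset.sum_add_distrib]
  ring

/-- The mixed component of the trace of the curvature form is the divergence of the torsion. -/
theorem ext_traceConn_z_t (a : Fin n) : S.ext S.traceConn (z a) t = S.divTorsion a := by
  rw [ext_traceConn_conj, bar_z, bar_t, ext_traceConn_zb_t, divTorsion_eq]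
  simp only [map_sum, map_add, map_sub, map_mul, S.conj_conj, E_zb]

/-! ### The Schur argument from the Bianchi identity -/

/-- A form of Schur's lemma: if the Ricci tensor is `f` times the Levi form, then `f` satisfies
`∇_α f = i ∇^β A_{αβ}`. -/
theorem E_eq_divTorsion_of_ricci_eq (hn : 2 ≤ n) (f : A)
    (hf : ∀ a b, S.ricci a b = f * S.h a b) (a : Fin n) :
    S.E (z a) f = S.I * S.divTorsion a := by
  have hK : ∀ a b, S.ext S.traceConn (z a) (zb b) = f * S.h a b := hf
  have hK' : ∀ a b, S.ext S.traceConn (zb b) (z a) = -(f * S.h a b) := fun a b => by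
    rw [S.ext_swap, hK]
  have hT : ∀ a, S.ext S.traceConn t (z a) = -S.divTorsion a := fun a => by
    rw [S.ext_swap, ext_traceConn_z_t]
  -- The Bianchi identity `d² ω_γ^γ = 0` on `Z_a, Z_b, Z_ḡ`. All terms containing `f`
  -- undifferentiated add up to `f` times `E_z_h` and drop out.
  have key : ∀ b g, (S.E (z a) f - S.I * S.divTorsion a) * S.h b g
      = (S.E (z b) f - S.I * S.divTorsion b) * S.h a g := by
    intro b g
    have h1 := S.ext_ext S.traceConn (z a) (z b) (zb g)
    have h2 := S.E_z_h a b g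
    rw [sum_eq] at h1
    simp only [hK, hK', hT, ext_traceConn_z_z, c_z_z_t, c_z_z_zb, c_z_zb_t, c_zb_z_t, c_z_zb_zb,
      c_zb_z_zb, zero_mul, mul_zero, zero_add, add_zero, map_zero, map_neg, Derivation.leibniz,
      smul_eq_mul, Finset.sum_add_distrib, neg_mul, mul_neg, neg_neg, Finset.sum_neg_distrib] at h1
    have e1 : ∑ m, S.c (z a) (z b) (z m) * (f * S.h m g)
        = f * ∑ m, S.h m g * S.c (z a) (z b) (z m) := by
      rw [Finset.mul_sum]; exact Finset.sum_congr rfl fun _ _ => by ring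
    have e2 : ∀ x y, ∑ m, S.conj (S.connBar x g m) * (f * S.h y m)
        = f * ∑ m, S.h y m * S.conj (S.connBar x g m) := fun x y => by
      rw [Finset.mul_sum]; exact Finset.sum_congr rfl fun _ _ => by ring
    simp only [e1, e2] at h1
    linear_combination h1 - f * h2
  have : Nontrivial (Fin n) := Fin.nontrivial_iff_two_le.mpr hn
  obtain ⟨b, hb⟩ := exists_ne a
  -- Contraction with `h^{bḡ}` for an index `b ≠ a`: the left side keeps its factor, while on the
  -- right `h^{bḡ} h_{aḡ} = 0`. A second index exists only because `n ≥ 2`.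
  have h3 : ∑ g, S.hInv b g * ((S.E (z a) f - S.I * S.divTorsion a) * S.h b g)
      = ∑ g, S.hInv b g * ((S.E (z b) f - S.I * S.divTorsion b) * S.h a g) :=
    Finset.sum_congr rfl fun g _ => by rw [key]
  have e : ∀ x y, ∑ g, S.hInv b g * (x * S.h y g) = x * if b = y then 1 else 0 := fun x y => by
    rw [← sum_hInv_h, Finset.mul_sum]; exact Finset.sum_congr rfl fun _ _ => by ring
  rw [e, e, if_pos rfl, if_neg hb] at h3
  linear_combination h3

end CRStructureFunctions

/-! ### Derivatives of complex functions along real fields -/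

section RealFields

variable {n : ℕ} {M : Type u} [TopologicalSpace M] [ChartedSpace (Model n) M]

/-- The derivative of a complex-valued function along a real vector field. -/
def dirDeriv (X : (p : M) → TangentSpace (𝓡 (2 * n + 1)) p) (f : M → ℂ) (p : M) : ℂ :=
  mvfderiv (𝓡 (2 * n + 1)) f p (X p)

/-- A complex-valued function is smooth on `U`. -/
def SmoothFunOn (n : ℕ) {M : Type u} [TopologicalSpace M] [ChartedSpace (Model n) M]
    (f : M → ℂ) (U : Set M) : Prop :=
  ContMDiffOn (𝓡 (2 * n + 1)) 𝓘(ℝ, ℂ) ∞ f U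

theorem CField.D_eq (Z : CField n M) (f : M → ℂ) (p : M) :
    Z.D f p = dirDeriv Z.re f p + Complex.I * dirDeriv Z.im f p := rfl

theorem SmoothFunOn.mdifferentiableAt {f : M → ℂ} {U : Set M} (hf : SmoothFunOn n f U)
    (hU : IsOpen U) {p : M} (hp : p ∈ U) :
    MDifferentiableAt (𝓡 (2 * n + 1)) 𝓘(ℝ, ℂ) f p :=
  ((hf p hp).contMDiffAt (hU.mem_nhds hp)).mdifferentiableAt (by simp)

theorem SmoothFunOn.congr {f g : M → ℂ} {U : Set M} (hf : SmoothFunOn n f U)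
    (hfg : ∀ p ∈ U, g p = f p) : SmoothFunOn n g U :=
  ContMDiffOn.congr hf hfg

theorem smoothFunOn_const (z : ℂ) (U : Set M) : SmoothFunOn n (fun _ : M => z) U :=
  contMDiffOn_const

theorem SmoothFunOn.add {f g : M → ℂ} {U : Set M} (hf : SmoothFunOn n f U)
    (hg : SmoothFunOn n g U) : SmoothFunOn n (fun p => f p + g p) U :=
  ContMDiffOn.add hf hg

theorem SmoothFunOn.neg {f : M → ℂ} {U : Set M} (hf : SmoothFunOn n f U) :
    SmoothFunOn n (fun p => -f p) U :=
  ContMDiffOn.neg hf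

theorem SmoothFunOn.comp_contDiff {f : M → ℂ} {U : Set M} (hf : SmoothFunOn n f U) {g : ℂ → ℂ}
    (hg : ContDiff ℝ ∞ g) : SmoothFunOn n (fun p => g (f p)) U :=
  hg.contMDiff.comp_contMDiffOn hf

theorem SmoothFunOn.mul {f g : M → ℂ} {U : Set M} (hf : SmoothFunOn n f U)
    (hg : SmoothFunOn n g U) : SmoothFunOn n (fun p => f p * g p) U :=
  (contDiff_mul (𝕜 := ℝ) (𝔸 := ℂ)).contMDiff.comp_contMDiffOn (ContMDiffOn.prodMk_space hf hg)

theorem SmoothFunOn.conj {f : M → ℂ} {U : Set M} (hf : SmoothFunOn n f U) :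
    SmoothFunOn n (fun p => starRingEnd ℂ (f p)) U :=
  hf.comp_contDiff Complex.conjCLE.contDiff

theorem SmoothFunOn.inv {f : M → ℂ} {U : Set M} (hf : SmoothFunOn n f U)
    (h0 : ∀ p ∈ U, f p ≠ 0) : SmoothFunOn n (fun p => (f p)⁻¹) U := fun p hp =>
  ((contDiffAt_inv ℝ (h0 p hp)).contMDiffAt).comp_contMDiffWithinAt p (hf p hp)

theorem dirDeriv_congr (X : (p : M) → TangentSpace (𝓡 (2 * n + 1)) p) {f g : M → ℂ} {U : Set M}
    (hU : IsOpen U) (hfg : ∀ p ∈ U, f p = g p) {p : M} (hp : p ∈ U) :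
    dirDeriv X f p = dirDeriv X g p := by
  have : f =ᶠ[nhds p] g := Filter.eventuallyEq_of_mem (hU.mem_nhds hp) hfg
  have h := this.mfderiv_eq (I := 𝓡 (2 * n + 1)) (I' := 𝓘(ℝ, ℂ))
  exact congrArg (fun L : TangentSpace (𝓡 (2 * n + 1)) p →L[ℝ] ℂ => L (X p)) h

theorem dirDeriv_add (X : (p : M) → TangentSpace (𝓡 (2 * n + 1)) p) {f g : M → ℂ} {p : M}
    (hf : MDifferentiableAt (𝓡 (2 * n + 1)) 𝓘(ℝ, ℂ) f p)
    (hg : MDifferentiableAt (𝓡 (2 * n + 1)) 𝓘(ℝ, ℂ) g p) :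
    dirDeriv X (fun q => f q + g q) p = dirDeriv X f p + dirDeriv X g p := by
  have := mvfderiv_fun_add hf hg
  rw [dirDeriv, this]; rfl

theorem dirDeriv_mul (X : (p : M) → TangentSpace (𝓡 (2 * n + 1)) p) {f g : M → ℂ} {p : M}
    (hf : MDifferentiableAt (𝓡 (2 * n + 1)) 𝓘(ℝ, ℂ) f p)
    (hg : MDifferentiableAt (𝓡 (2 * n + 1)) 𝓘(ℝ, ℂ) g p) :
    dirDeriv X (fun q => f q * g q) p = f p * dirDeriv X g p + g p * dirDeriv X f p := by
  have h := (hf.hasMFDerivAt.mul hg.hasMFDerivAt).mfderiv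
  exact congrArg (fun L : TangentSpace (𝓡 (2 * n + 1)) p →L[ℝ] ℂ => L (X p)) h

theorem dirDeriv_const (X : (p : M) → TangentSpace (𝓡 (2 * n + 1)) p) (z : ℂ) (p : M) :
    dirDeriv X (fun _ => z) p = 0 := by
  rw [dirDeriv, mvfderiv_const]; rfl

/-- Derivatives commute with continuous real-linear maps. -/
theorem mvfderiv_clm_comp {F : Type*} [NormedAddCommGroup F] [NormedSpace ℝ F] (L : ℂ →L[ℝ] F)
    {f : M → ℂ} {p : M} (hf : MDifferentiableAt (𝓡 (2 * n + 1)) 𝓘(ℝ, ℂ) f p)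
    (v : TangentSpace (𝓡 (2 * n + 1)) p) :
    mvfderiv (𝓡 (2 * n + 1)) (fun q => L (f q)) p v = L (mvfderiv (𝓡 (2 * n + 1)) f p v) := by
  have h := (L.hasMFDerivAt (x := f p)).comp p hf.hasMFDerivAt
  exact congrArg (fun L : TangentSpace (𝓡 (2 * n + 1)) p →L[ℝ] F => L v) h.mfderiv

/-- Differentiability need not be assumed: `f` and its conjugate are differentiable at the same
points, and elsewhere both derivatives have the default value 0. -/
theorem dirDeriv_conj (X : (p : M) → TangentSpace (𝓡 (2 * n + 1)) p) (f : M → ℂ) (p : M) :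
    dirDeriv X (fun q => starRingEnd ℂ (f q)) p = starRingEnd ℂ (dirDeriv X f p) := by
  by_cases hf : MDifferentiableAt (𝓡 (2 * n + 1)) 𝓘(ℝ, ℂ) f p
  · exact mvfderiv_clm_comp (Complex.conjCLE : ℂ →L[ℝ] ℂ) hf (X p)
  · have hf' : ¬MDifferentiableAt (𝓡 (2 * n + 1)) 𝓘(ℝ, ℂ) (fun q => starRingEnd ℂ (f q)) p := by
      intro h
      apply hf
      have := ((Complex.conjCLE : ℂ →L[ℝ] ℂ).mdifferentiableAt).comp p h
      refine this.congr_of_eventuallyEq (Filter.Eventually.of_forall fun q => ?_)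
      simp
    have e1 := mfderiv_zero_of_not_mdifferentiableAt hf
    have e2 := mfderiv_zero_of_not_mdifferentiableAt hf'
    simp only [dirDeriv, mvfderiv, e1, e2]
    simp

theorem dirDeriv_eq_re_im (X : (p : M) → TangentSpace (𝓡 (2 * n + 1)) p) {f : M → ℂ} {p : M}
    (hf : MDifferentiableAt (𝓡 (2 * n + 1)) 𝓘(ℝ, ℂ) f p) :
    dirDeriv X f p = (mvfderiv (𝓡 (2 * n + 1)) (fun q => (f q).re) p (X p) : ℂ)
      + Complex.I * (mvfderiv (𝓡 (2 * n + 1)) (fun q => (f q).im) p (X p) : ℂ) := by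
  have h1 := mvfderiv_clm_comp Complex.reCLM hf (X p)
  have h2 := mvfderiv_clm_comp Complex.imCLM hf (X p)
  simp only [Complex.reCLM_apply, Complex.imCLM_apply] at h1 h2
  rw [h1, h2]
  exact (Complex.re_add_im _).symm.trans (by rw [mul_comm]; rfl)

end RealFields

/-! ### Smoothness of fields, brackets and derivatives -/

section SmoothFields

variable {n : ℕ} {M : Type u} [TopologicalSpace M] [ChartedSpace (Model n) M]
  [IsManifold (𝓡 (2 * n + 1)) ∞ M]
  {X Y : (p : M) → TangentSpace (𝓡 (2 * n + 1)) p} {U : Set M} {p : M}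

theorem SmoothFieldOn.contMDiffAt (hX : SmoothFieldOn X U) (hU : IsOpen U) (hp : p ∈ U) :
    ContMDiffAt (𝓡 (2 * n + 1)) (𝓡 (2 * n + 1)).tangent ∞
      (fun p => (⟨p, X p⟩ : TangentBundle (𝓡 (2 * n + 1)) M)) p :=
  (hX p hp).contMDiffAt (hU.mem_nhds hp)

theorem SmoothFieldOn.mdifferentiableAt (hX : SmoothFieldOn X U) (hU : IsOpen U) (hp : p ∈ U) :
    MDifferentiableAt (𝓡 (2 * n + 1)) (𝓡 (2 * n + 1)).tangent
      (fun p => (⟨p, X p⟩ : TangentBundle (𝓡 (2 * n + 1)) M)) p :=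
  (hX.contMDiffAt hU hp).mdifferentiableAt (by simp)

theorem SmoothFieldOn.mlieBracket (hU : IsOpen U) (hX : SmoothFieldOn X U)
    (hY : SmoothFieldOn Y U) :
    SmoothFieldOn (fun p => VectorField.mlieBracket (𝓡 (2 * n + 1)) X Y p) U := by
  intro p hp
  -- Here `∞ + 1` is `∞`, so taking a bracket loses no regularity.
  have : IsManifold (𝓡 (2 * n + 1)) (((⊤ : ℕ∞) : WithTop ℕ∞) + 1) M :=
    inferInstanceAs (IsManifold (𝓡 (2 * n + 1)) ∞ M)
  have : IsManifold (𝓡 (2 * n + 1)) (minSmoothness ℝ 2) M := by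
    rw [minSmoothness_of_isRCLikeNormedField]; infer_instance
  exact (ContMDiffAt.mlieBracket_vectorField (m := ⊤) (n := ⊤) (hX.contMDiffAt hU hp)
    (hY.contMDiffAt hU hp) (by simp)).contMDiffWithinAt

theorem SmoothFieldOn.add (hX : SmoothFieldOn X U) (hY : SmoothFieldOn Y U) :
    SmoothFieldOn (fun p => X p + Y p) U :=
  ContMDiffOn.add_section hX hY

theorem SmoothFieldOn.neg (hX : SmoothFieldOn X U) : SmoothFieldOn (fun p => -X p) U :=
  ContMDiffOn.neg_section hX

theorem SmoothFieldOn.sub (hX : SmoothFieldOn X U) (hY : SmoothFieldOn Y U) :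
    SmoothFieldOn (fun p => X p - Y p) U := by
  simpa only [sub_eq_add_neg] using hX.add hY.neg

theorem SmoothFieldOn.smul {f : M → ℝ} (hf : ContMDiffOn (𝓡 (2 * n + 1)) 𝓘(ℝ, ℝ) ∞ f U)
    (hX : SmoothFieldOn X U) : SmoothFieldOn (fun p => f p • X p) U :=
  ContMDiffOn.smul_section hf hX

theorem smoothFieldOn_zero (U : Set M) :
    SmoothFieldOn (fun p => (0 : TangentSpace (𝓡 (2 * n + 1)) p)) U :=
  (Bundle.contMDiff_zeroSection ℝ
    (TangentSpace (𝓡 (2 * n + 1)) : M → Type)).contMDiffOn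

/-- The derivative `X f` is the fibre component of the tangent map of `f` composed with the section
`X`, a composition of smooth maps. -/
theorem SmoothFunOn.dirDeriv {f : M → ℂ} (hU : IsOpen U) (hf : SmoothFunOn n f U)
    (hX : SmoothFieldOn X U) : SmoothFunOn n (dirDeriv X f) U := by
  have h1 := ContMDiffOn.contMDiffOn_tangentMapWithin (m := ∞) hf (by simp) hU.uniqueMDiffOn
  have h2 := h1.comp (t := _) hX (fun p hp => hp)
  refine ((contMDiff_snd_tangentBundle_modelSpace ℂ 𝓘(ℝ, ℂ)).comp_contMDiffOn h2).congr
    fun p hp => ?_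
  exact congrArg (fun L : TangentSpace (𝓡 (2 * n + 1)) p →L[ℝ] ℂ => L (X p))
    (mfderivWithin_of_isOpen hU hp).symm

end SmoothFields

section

variable {n : ℕ} {M : Type u} [TopologicalSpace M] [ChartedSpace (Model n) M]

theorem contMDiffOn_re {f : M → ℂ} {U : Set M} (hf : SmoothFunOn n f U) :
    ContMDiffOn (𝓡 (2 * n + 1)) 𝓘(ℝ, ℝ) ∞ (fun q => (f q).re) U :=
  Complex.reCLM.contDiff.contMDiff.comp_contMDiffOn hf

theorem contMDiffOn_im {f : M → ℂ} {U : Set M} (hf : SmoothFunOn n f U) :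
    ContMDiffOn (𝓡 (2 * n + 1)) 𝓘(ℝ, ℝ) ∞ (fun q => (f q).im) U :=
  Complex.imCLM.contDiff.contMDiff.comp_contMDiffOn hf

theorem mlieBracket_congr_on {X Y : (p : M) → TangentSpace (𝓡 (2 * n + 1)) p} {U : Set M} {p : M}
    (hU : IsOpen U) (hp : p ∈ U)
    {X' Y' : (p : M) → TangentSpace (𝓡 (2 * n + 1)) p}
    (hX : ∀ q ∈ U, X q = X' q) (hY : ∀ q ∈ U, Y q = Y' q) :
    VectorField.mlieBracket (𝓡 (2 * n + 1)) X Y p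
      = VectorField.mlieBracket (𝓡 (2 * n + 1)) X' Y' p :=
  Filter.EventuallyEq.mlieBracket_vectorField_eq
    (Filter.eventuallyEq_of_mem (hU.mem_nhds hp) hX)
    (Filter.eventuallyEq_of_mem (hU.mem_nhds hp) hY)

end

/-! ### Calculus of the Lie bracket of real fields -/

section Brackets

variable {n : ℕ} {M : Type u} [TopologicalSpace M] [ChartedSpace (Model n) M]
  [IsManifold (𝓡 (2 * n + 1)) ∞ M]
  {X Y W : (p : M) → TangentSpace (𝓡 (2 * n + 1)) p} {U : Set M} {p : M}

theorem mlieBracket_sub_right (hU : IsOpen U) (hp : p ∈ U) (hY : SmoothFieldOn Y U)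
    (hW : SmoothFieldOn W U) :
    VectorField.mlieBracket (𝓡 (2 * n + 1)) X (fun q => Y q - W q) p
      = VectorField.mlieBracket (𝓡 (2 * n + 1)) X Y p
        - VectorField.mlieBracket (𝓡 (2 * n + 1)) X W p := by
  have e : (fun q => Y q - W q) = Y + (-1 : ℝ) • W := by
    ext q; simp [sub_eq_add_neg]
  have hW' : MDifferentiableAt (𝓡 (2 * n + 1)) (𝓡 (2 * n + 1)).tangent
      (fun p => (⟨p, ((-1 : ℝ) • W) p⟩ : TangentBundle (𝓡 (2 * n + 1)) M)) p :=
    (SmoothFieldOn.smul (f := fun _ => (-1 : ℝ)) contMDiffOn_const hW).mdifferentiableAt hU hp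
  rw [e, VectorField.mlieBracket_add_right (hY.mdifferentiableAt hU hp) hW',
    VectorField.mlieBracket_const_smul_right (hW.mdifferentiableAt hU hp)]
  simp [sub_eq_add_neg]

theorem mlieBracket_add_right (hU : IsOpen U) (hp : p ∈ U) (hY : SmoothFieldOn Y U)
    (hW : SmoothFieldOn W U) :
    VectorField.mlieBracket (𝓡 (2 * n + 1)) X (fun q => Y q + W q) p
      = VectorField.mlieBracket (𝓡 (2 * n + 1)) X Y p
        + VectorField.mlieBracket (𝓡 (2 * n + 1)) X W p :=
  VectorField.mlieBracket_add_right (hY.mdifferentiableAt hU hp) (hW.mdifferentiableAt hU hp)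

theorem mlieBracket_sub_left (hU : IsOpen U) (hp : p ∈ U) (hY : SmoothFieldOn Y U)
    (hW : SmoothFieldOn W U) :
    VectorField.mlieBracket (𝓡 (2 * n + 1)) (fun q => Y q - W q) X p
      = VectorField.mlieBracket (𝓡 (2 * n + 1)) Y X p
        - VectorField.mlieBracket (𝓡 (2 * n + 1)) W X p := by
  rw [VectorField.mlieBracket_swap_apply, mlieBracket_sub_right hU hp hY hW,
    VectorField.mlieBracket_swap_apply (V := Y), VectorField.mlieBracket_swap_apply (V := W)]
  abel

theorem mlieBracket_add_left (hU : IsOpen U) (hp : p ∈ U) (hY : SmoothFieldOn Y U)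
    (hW : SmoothFieldOn W U) :
    VectorField.mlieBracket (𝓡 (2 * n + 1)) (fun q => Y q + W q) X p
      = VectorField.mlieBracket (𝓡 (2 * n + 1)) Y X p
        + VectorField.mlieBracket (𝓡 (2 * n + 1)) W X p :=
  VectorField.mlieBracket_add_left (hY.mdifferentiableAt hU hp) (hW.mdifferentiableAt hU hp)

theorem mlieBracket_smul_right {f : M → ℝ} (hU : IsOpen U) (hp : p ∈ U)
    (hf : ContMDiffOn (𝓡 (2 * n + 1)) 𝓘(ℝ, ℝ) ∞ f U) (hY : SmoothFieldOn Y U) :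
    VectorField.mlieBracket (𝓡 (2 * n + 1)) X (fun q => f q • Y q) p
      = mvfderiv (𝓡 (2 * n + 1)) f p (X p) • Y p
        + f p • VectorField.mlieBracket (𝓡 (2 * n + 1)) X Y p :=
  VectorField.mlieBracket_smul_right
    (((hf p hp).contMDiffAt (hU.mem_nhds hp)).mdifferentiableAt (by simp))
    (hY.mdifferentiableAt hU hp)

theorem jacobi_mlieBracket (hU : IsOpen U) (hp : p ∈ U) (hX : SmoothFieldOn X U)
    (hY : SmoothFieldOn Y U) (hW : SmoothFieldOn W U) :
    VectorField.mlieBracket (𝓡 (2 * n + 1)) X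
        (fun q => VectorField.mlieBracket (𝓡 (2 * n + 1)) Y W q) p
      = VectorField.mlieBracket (𝓡 (2 * n + 1))
          (fun q => VectorField.mlieBracket (𝓡 (2 * n + 1)) X Y q) W p
        + VectorField.mlieBracket (𝓡 (2 * n + 1)) Y
          (fun q => VectorField.mlieBracket (𝓡 (2 * n + 1)) X W q) p := by
  have : IsManifold (𝓡 (2 * n + 1)) (minSmoothness ℝ 3) M := by
    rw [minSmoothness_of_isRCLikeNormedField]; infer_instance
  have h2 : minSmoothness ℝ 2 ≤ ∞ := by
    rw [minSmoothness_of_isRCLikeNormedField]; exact ENat.LEInfty.out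
  exact VectorField.leibniz_identity_mlieBracket_apply ((hX.contMDiffAt hU hp).of_le h2)
    ((hY.contMDiffAt hU hp).of_le h2) ((hW.contMDiffAt hU hp).of_le h2)

theorem SmoothFieldOn.sum {ι : Type*} (s : Finset ι)
    {Y : ι → (p : M) → TangentSpace (𝓡 (2 * n + 1)) p} (hY : ∀ i, SmoothFieldOn (Y i) U) :
    SmoothFieldOn (fun q => ∑ i ∈ s, Y i q) U :=
  ContMDiffOn.sum_section fun i _ => hY i

theorem mlieBracket_sum_smul_right {ι : Type*} (s : Finset ι) {f : ι → M → ℝ}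
    {Y : ι → (p : M) → TangentSpace (𝓡 (2 * n + 1)) p} (hU : IsOpen U) (hp : p ∈ U)
    (hf : ∀ i, ContMDiffOn (𝓡 (2 * n + 1)) 𝓘(ℝ, ℝ) ∞ (f i) U)
    (hY : ∀ i, SmoothFieldOn (Y i) U) :
    VectorField.mlieBracket (𝓡 (2 * n + 1)) X (fun q => ∑ i ∈ s, f i q • Y i q) p
      = ∑ i ∈ s, (mvfderiv (𝓡 (2 * n + 1)) (f i) p (X p) • Y i p
        + f i p • VectorField.mlieBracket (𝓡 (2 * n + 1)) X (Y i) p) := by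
  classical
  induction s using Finset.induction_on with
  | empty =>
    simp only [Finset.sum_empty]
    exact congrFun VectorField.mlieBracket_zero_right p
  | insert i s hi ih =>
    simp only [Finset.sum_insert hi]
    rw [mlieBracket_add_right hU hp (SmoothFieldOn.smul (hf i) (hY i))
      (SmoothFieldOn.sum s fun j => SmoothFieldOn.smul (hf j) (hY j)), ih,
      mlieBracket_smul_right hU hp (hf i) (hY i)]

theorem mlieBracket_sum_smul_add_smul_right {ι : Type*} [Fintype ι] {f g : ι → M → ℝ}
    {Y W : ι → (p : M) → TangentSpace (𝓡 (2 * n + 1)) p} (hU : IsOpen U) (hp : p ∈ U)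
    (hf : ∀ i, ContMDiffOn (𝓡 (2 * n + 1)) 𝓘(ℝ, ℝ) ∞ (f i) U)
    (hg : ∀ i, ContMDiffOn (𝓡 (2 * n + 1)) 𝓘(ℝ, ℝ) ∞ (g i) U)
    (hY : ∀ i, SmoothFieldOn (Y i) U) (hW : ∀ i, SmoothFieldOn (W i) U) :
    VectorField.mlieBracket (𝓡 (2 * n + 1)) X (fun q => ∑ i, (f i q • Y i q + g i q • W i q)) p
      = ∑ i, (mvfderiv (𝓡 (2 * n + 1)) (f i) p (X p) • Y i p
        + f i p • VectorField.mlieBracket (𝓡 (2 * n + 1)) X (Y i) p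
        + (mvfderiv (𝓡 (2 * n + 1)) (g i) p (X p) • W i p
        + g i p • VectorField.mlieBracket (𝓡 (2 * n + 1)) X (W i) p)) := by
  simp only [Finset.sum_add_distrib (f := fun i => f i _ • Y i _)]
  rw [mlieBracket_add_right hU hp (SmoothFieldOn.sum _ fun j => SmoothFieldOn.smul (hf j) (hY j))
    (SmoothFieldOn.sum _ fun j => SmoothFieldOn.smul (hg j) (hW j)),
    mlieBracket_sum_smul_right _ hU hp hf hY, mlieBracket_sum_smul_right _ hU hp hg hW,
    ← Finset.sum_add_distrib]

/-- The Lie bracket acts on functions as the commutator. The auxiliary field `W` only has to be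
nonzero at the point. -/
theorem mvfderiv_mlieBracket {f : M → ℝ} (hU : IsOpen U) (hp : p ∈ U) (hX : SmoothFieldOn X U)
    (hY : SmoothFieldOn Y U) (hW : SmoothFieldOn W U) (hWp : W p ≠ 0)
    (hf : ContMDiffOn (𝓡 (2 * n + 1)) 𝓘(ℝ, ℝ) ∞ f U)
    (hXf : ContMDiffOn (𝓡 (2 * n + 1)) 𝓘(ℝ, ℝ) ∞
      (fun q => mvfderiv (𝓡 (2 * n + 1)) f q (X q)) U)
    (hYf : ContMDiffOn (𝓡 (2 * n + 1)) 𝓘(ℝ, ℝ) ∞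
      (fun q => mvfderiv (𝓡 (2 * n + 1)) f q (Y q)) U) :
    mvfderiv (𝓡 (2 * n + 1)) f p (VectorField.mlieBracket (𝓡 (2 * n + 1)) X Y p)
      = mvfderiv (𝓡 (2 * n + 1)) (fun q => mvfderiv (𝓡 (2 * n + 1)) f q (Y q)) p (X p)
        - mvfderiv (𝓡 (2 * n + 1)) (fun q => mvfderiv (𝓡 (2 * n + 1)) f q (X q)) p (Y p) := by
  -- The Jacobi identity for `X, Y, fW` is expanded by the Leibniz rule. First derivatives of `f`
  -- and brackets with `W` cancel, and the remaining multiple of `W p` is `[X,Y]f - XYf + YXf`.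
  have key := jacobi_mlieBracket hU hp hX hY (SmoothFieldOn.smul hf hW)
  have expand : ∀ {X Y : (p : M) → TangentSpace (𝓡 (2 * n + 1)) p}, SmoothFieldOn Y U →
      ContMDiffOn (𝓡 (2 * n + 1)) 𝓘(ℝ, ℝ) ∞
        (fun q => mvfderiv (𝓡 (2 * n + 1)) f q (Y q)) U →
      VectorField.mlieBracket (𝓡 (2 * n + 1)) X (fun q =>
        VectorField.mlieBracket (𝓡 (2 * n + 1)) Y (fun q => f q • W q) q) p
      = mvfderiv (𝓡 (2 * n + 1)) (fun q => mvfderiv (𝓡 (2 * n + 1)) f q (Y q)) p (X p) • W p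
        + mvfderiv (𝓡 (2 * n + 1)) f p (Y p) • VectorField.mlieBracket (𝓡 (2 * n + 1)) X W p
        + (mvfderiv (𝓡 (2 * n + 1)) f p (X p) • VectorField.mlieBracket (𝓡 (2 * n + 1)) Y W p
        + f p • VectorField.mlieBracket (𝓡 (2 * n + 1)) X
          (fun q => VectorField.mlieBracket (𝓡 (2 * n + 1)) Y W q) p) := by
    intro X Y hY hYf
    rw [mlieBracket_congr_on hU hp (fun _ _ => rfl)
      (fun q hq => mlieBracket_smul_right (X := Y) hU hq hf hW),
      mlieBracket_add_right hU hp (SmoothFieldOn.smul hYf hW)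
        (SmoothFieldOn.smul hf (hY.mlieBracket hU hW)),
      mlieBracket_smul_right hU hp hYf hW,
      mlieBracket_smul_right hU hp hf (hY.mlieBracket hU hW)]
  rw [expand hY hYf, expand hX hXf, mlieBracket_smul_right hU hp hf hW,
    jacobi_mlieBracket hU hp hX hY hW] at key
  have h0 : (mvfderiv (𝓡 (2 * n + 1)) f p (VectorField.mlieBracket (𝓡 (2 * n + 1)) X Y p)
      - (mvfderiv (𝓡 (2 * n + 1)) (fun q => mvfderiv (𝓡 (2 * n + 1)) f q (Y q)) p (X p)
        - mvfderiv (𝓡 (2 * n + 1)) (fun q => mvfderiv (𝓡 (2 * n + 1)) f q (X q)) p (Y p)))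
      • W p = 0 := by
    rw [sub_smul, sub_smul, sub_eq_zero, eq_sub_iff_add_eq]
    rw [smul_add, ← sub_eq_zero] at key
    rw [← sub_eq_zero, ← neg_eq_zero, ← key]
    abel
  exact sub_eq_zero.1 ((smul_eq_zero.1 h0).resolve_right hWp)

theorem dirDeriv_mlieBracket {f : M → ℂ} (hU : IsOpen U) (hp : p ∈ U) (hX : SmoothFieldOn X U)
    (hY : SmoothFieldOn Y U) (hW : SmoothFieldOn W U) (hWp : W p ≠ 0)
    (hf : SmoothFunOn n f U) :
    dirDeriv (fun q => VectorField.mlieBracket (𝓡 (2 * n + 1)) X Y q) f p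
      = dirDeriv X (dirDeriv Y f) p - dirDeriv Y (dirDeriv X f) p := by
  -- The real-valued result is applied to `L ∘ f` for a real functional `L`; the real and imaginary
  -- parts then determine the complex identity.
  have part : ∀ L : ℂ →L[ℝ] ℝ,
      L (dirDeriv (fun q => VectorField.mlieBracket (𝓡 (2 * n + 1)) X Y q) f p)
      = L (dirDeriv X (dirDeriv Y f) p) - L (dirDeriv Y (dirDeriv X f) p) := by
    intro L
    have hL : ∀ {g : M → ℂ}, SmoothFunOn n g U →
        ContMDiffOn (𝓡 (2 * n + 1)) 𝓘(ℝ, ℝ) ∞ (fun q => L (g q)) U := fun hg =>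
      L.contDiff.contMDiff.comp_contMDiffOn hg
    have e : ∀ {g : M → ℂ} (V : (p : M) → TangentSpace (𝓡 (2 * n + 1)) p), SmoothFunOn n g U →
        ∀ q ∈ U, mvfderiv (𝓡 (2 * n + 1)) (fun r => L (g r)) q (V q) = L (dirDeriv V g q) :=
      fun V hg q hq => mvfderiv_clm_comp L (hg.mdifferentiableAt hU hq) (V q)
    have e2 : ∀ V V' : (p : M) → TangentSpace (𝓡 (2 * n + 1)) p, SmoothFieldOn V U →
        mvfderiv (𝓡 (2 * n + 1))
          (fun q => mvfderiv (𝓡 (2 * n + 1)) (fun r => L (f r)) q (V q)) p (V' p)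
          = L (dirDeriv V' (dirDeriv V f) p) := by
      intro V V' hV
      rw [← e V' (hf.dirDeriv hU hV) p hp]
      have : (fun q => mvfderiv (𝓡 (2 * n + 1)) (fun r => L (f r)) q (V q))
          =ᶠ[nhds p] fun q => L (dirDeriv V f q) :=
        Filter.eventuallyEq_of_mem (hU.mem_nhds hp) (e V hf)
      have h := this.mfderiv_eq (I := 𝓡 (2 * n + 1)) (I' := 𝓘(ℝ, ℝ))
      exact congrArg (fun K : TangentSpace (𝓡 (2 * n + 1)) p →L[ℝ] ℝ => K (V' p)) h
    have := mvfderiv_mlieBracket hU hp hX hY hW hWp (hL hf)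
      ((hL (hf.dirDeriv hU hX)).congr (e X hf)) ((hL (hf.dirDeriv hU hY)).congr (e Y hf))
    rw [e2 Y X hY, e2 X Y hX] at this
    rw [← this]
    exact (e _ hf p hp).symm
  exact Complex.ext (part Complex.reCLM) (part Complex.imCLM)

end Brackets

/-! ### Complex fields: conjugation, Leibniz rules, Jacobi identity -/

section ComplexFields

variable {n : ℕ} {M : Type u} [TopologicalSpace M] [ChartedSpace (Model n) M]

theorem CForm.conj_ap_conj (φ : CForm n M) (Z : CField n M) (p : M) :
    φ.conj.ap Z.conj p = starRingEnd ℂ (φ.ap Z p) := by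
  simp [CForm.ap, CForm.conj, CField.conj]

theorem CField.conj_conj (Z : CField n M) : Z.conj.conj = Z := by
  simp [CField.conj]

theorem CForm.conj_conj (φ : CForm n M) : φ.conj.conj = φ := by
  funext p
  ext v
  simp [CForm.conj]

theorem CField.D_conj (Z : CField n M) (f : M → ℂ) (p : M) :
    Z.conj.D (fun q => starRingEnd ℂ (f q)) p = starRingEnd ℂ (Z.D f p) := by
  rw [CField.D_eq, CField.D_eq, dirDeriv_conj, dirDeriv_conj, map_add, map_mul, Complex.conj_I]
  have : dirDeriv Z.conj.im f p = -dirDeriv Z.im f p := by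
    simp [dirDeriv, CField.conj]
  rw [this, map_neg]
  simp only [CField.conj]
  ring

theorem CField.D_congr (Z : CField n M) {f g : M → ℂ} {U : Set M} (hU : IsOpen U)
    (hfg : ∀ p ∈ U, f p = g p) {p : M} (hp : p ∈ U) : Z.D f p = Z.D g p := by
  rw [CField.D_eq, CField.D_eq, dirDeriv_congr _ hU hfg hp, dirDeriv_congr _ hU hfg hp]

theorem CField.D_const (Z : CField n M) (z : ℂ) (p : M) : Z.D (fun _ => z) p = 0 := by
  simp [CField.D_eq, dirDeriv_const]

theorem CField.D_const_on (Z : CField n M) {f : M → ℂ} {z : ℂ} {U : Set M} (hU : IsOpen U)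
    (hf : ∀ p ∈ U, f p = z) {p : M} (hp : p ∈ U) : Z.D f p = 0 := by
  rw [Z.D_congr hU hf hp, D_const]

theorem CField.D_add (Z : CField n M) {f g : M → ℂ} {U : Set M} (hU : IsOpen U)
    (hf : SmoothFunOn n f U) (hg : SmoothFunOn n g U) {p : M} (hp : p ∈ U) :
    Z.D (fun q => f q + g q) p = Z.D f p + Z.D g p := by
  simp only [CField.D_eq, dirDeriv_add _ (hf.mdifferentiableAt hU hp) (hg.mdifferentiableAt hU hp)]
  ring

theorem CField.D_neg (Z : CField n M) (f : M → ℂ) (p : M) :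
    Z.D (fun q => -f q) p = -Z.D f p := by
  have h : ∀ X : (p : M) → TangentSpace (𝓡 (2 * n + 1)) p,
      dirDeriv X (fun q => -f q) p = -dirDeriv X f p := fun X => by
    rw [dirDeriv, mvfderiv_fun_neg]; rfl
  rw [CField.D_eq, CField.D_eq, h, h]
  ring

theorem CField.D_mul (Z : CField n M) {f g : M → ℂ} {U : Set M} (hU : IsOpen U)
    (hf : SmoothFunOn n f U) (hg : SmoothFunOn n g U) {p : M} (hp : p ∈ U) :
    Z.D (fun q => f q * g q) p = f p * Z.D g p + g p * Z.D f p := by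
  simp only [CField.D_eq, dirDeriv_mul _ (hf.mdifferentiableAt hU hp) (hg.mdifferentiableAt hU hp)]
  ring

theorem CField.bracket_swap (Z W : CField n M) (φ : CForm n M) (p : M) :
    φ.ap (Z.bracket W) p = -φ.ap (W.bracket Z) p := by
  simp only [CForm.ap, CField.bracket]
  rw [VectorField.mlieBracket_swap_apply (V := Z.re) (W := W.re),
    VectorField.mlieBracket_swap_apply (V := Z.re) (W := W.im),
    VectorField.mlieBracket_swap_apply (V := Z.im) (W := W.re),
    VectorField.mlieBracket_swap_apply (V := Z.im) (W := W.im)]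
  simp only [map_sub, map_add, map_neg]
  ring

end ComplexFields

section SmoothComplexFields

variable {n : ℕ} {M : Type u} [TopologicalSpace M] [ChartedSpace (Model n) M]
  [IsManifold (𝓡 (2 * n + 1)) ∞ M] {U : Set M} {p : M}

theorem CField.SmoothOn.conj {Z : CField n M} (hZ : Z.SmoothOn U) : Z.conj.SmoothOn U :=
  ⟨hZ.1, hZ.2.neg⟩

theorem CField.SmoothOn.bracket {Z W : CField n M} (hU : IsOpen U) (hZ : Z.SmoothOn U)
    (hW : W.SmoothOn U) : (Z.bracket W).SmoothOn U :=
  ⟨(hZ.1.mlieBracket hU hW.1).sub (hZ.2.mlieBracket hU hW.2),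
    (hZ.1.mlieBracket hU hW.2).add (hZ.2.mlieBracket hU hW.1)⟩

theorem SmoothFunOn.D {f : M → ℂ} {Z : CField n M} (hU : IsOpen U) (hf : SmoothFunOn n f U)
    (hZ : Z.SmoothOn U) : SmoothFunOn n (Z.D f) U :=
  (hf.dirDeriv hU hZ.1).add ((smoothFunOn_const Complex.I U).mul (hf.dirDeriv hU hZ.2))

theorem CField.D_bracket {f : M → ℂ} {Z W V : CField n M} (hU : IsOpen U) (hp : p ∈ U)
    (hZ : Z.SmoothOn U) (hW : W.SmoothOn U) (hV : V.SmoothOn U) (hVp : V.re p ≠ 0)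
    (hf : SmoothFunOn n f U) :
    (Z.bracket W).D f p = Z.D (W.D f) p - W.D (Z.D f) p := by
  have hb : ∀ {X Y : (p : M) → TangentSpace (𝓡 (2 * n + 1)) p}, SmoothFieldOn X U →
      SmoothFieldOn Y U → mvfderiv (𝓡 (2 * n + 1)) f p
        (VectorField.mlieBracket (𝓡 (2 * n + 1)) X Y p)
      = dirDeriv X (dirDeriv Y f) p - dirDeriv Y (dirDeriv X f) p := fun hX hY =>
    dirDeriv_mlieBracket hU hp hX hY hV.1 hVp hf
  have hd : ∀ {Y Y' : (p : M) → TangentSpace (𝓡 (2 * n + 1)) p}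
      (X : (p : M) → TangentSpace (𝓡 (2 * n + 1)) p), SmoothFieldOn Y U →
      SmoothFieldOn Y' U → dirDeriv X (fun q => dirDeriv Y f q + Complex.I * dirDeriv Y' f q) p
        = dirDeriv X (dirDeriv Y f) p + Complex.I * dirDeriv X (dirDeriv Y' f) p := by
    intro Y Y' X hY hY'
    have h1 := (hf.dirDeriv hU hY).mdifferentiableAt hU hp
    have h2 := (hf.dirDeriv hU hY').mdifferentiableAt hU hp
    have h3 := (smoothFunOn_const (n := n) Complex.I U).mdifferentiableAt hU hp
    have h4 := ((smoothFunOn_const (n := n) Complex.I U).mul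
      (hf.dirDeriv hU hY')).mdifferentiableAt hU hp
    rw [dirDeriv_add X h1 h4, dirDeriv_mul X h3 h2, dirDeriv_const, mul_zero, add_zero]
  have e1 : Z.D f = fun q => dirDeriv Z.re f q + Complex.I * dirDeriv Z.im f q := rfl
  have e2 : W.D f = fun q => dirDeriv W.re f q + Complex.I * dirDeriv W.im f q := rfl
  have e3 : (Z.bracket W).D f p
      = mvfderiv (𝓡 (2 * n + 1)) f p (VectorField.mlieBracket (𝓡 (2 * n + 1)) Z.re W.re p)
        - mvfderiv (𝓡 (2 * n + 1)) f p (VectorField.mlieBracket (𝓡 (2 * n + 1)) Z.im W.im p)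
        + Complex.I *
        (mvfderiv (𝓡 (2 * n + 1)) f p (VectorField.mlieBracket (𝓡 (2 * n + 1)) Z.re W.im p)
        + mvfderiv (𝓡 (2 * n + 1)) f p
          (VectorField.mlieBracket (𝓡 (2 * n + 1)) Z.im W.re p)) := by
    simp only [CField.D_eq, dirDeriv, CField.bracket, map_sub, map_add]
  rw [e3, hb hZ.1 hW.1, hb hZ.2 hW.2, hb hZ.1 hW.2, hb hZ.2 hW.1, CField.D_eq Z, CField.D_eq W,
    e1, e2, hd _ hZ.1 hZ.2, hd _ hZ.1 hZ.2, hd _ hW.1 hW.2, hd _ hW.1 hW.2]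
  linear_combination (dirDeriv W.im (dirDeriv Z.im f) p - dirDeriv Z.im (dirDeriv W.im f) p)
    * Complex.I_sq

theorem CForm.ap_jacobi (φ : CForm n M) {Z W V : CField n M} (hU : IsOpen U) (hp : p ∈ U)
    (hZ : Z.SmoothOn U) (hW : W.SmoothOn U) (hV : V.SmoothOn U) :
    φ.ap (Z.bracket (W.bracket V)) p
      = φ.ap ((Z.bracket W).bracket V) p + φ.ap (W.bracket (Z.bracket V)) p := by
  have hb : ∀ {X Y : (p : M) → TangentSpace (𝓡 (2 * n + 1)) p}, SmoothFieldOn X U →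
      SmoothFieldOn Y U → _ := fun hX hY => SmoothFieldOn.mlieBracket hU hX hY
  simp only [CForm.ap, CField.bracket]
  rw [mlieBracket_sub_right hU hp (hb hW.1 hV.1) (hb hW.2 hV.2),
    mlieBracket_sub_right hU hp (hb hW.1 hV.1) (hb hW.2 hV.2),
    mlieBracket_sub_right hU hp (hb hZ.1 hV.1) (hb hZ.2 hV.2),
    mlieBracket_sub_right hU hp (hb hZ.1 hV.1) (hb hZ.2 hV.2),
    mlieBracket_add_right hU hp (hb hW.1 hV.2) (hb hW.2 hV.1),
    mlieBracket_add_right hU hp (hb hW.1 hV.2) (hb hW.2 hV.1),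
    mlieBracket_add_right hU hp (hb hZ.1 hV.2) (hb hZ.2 hV.1),
    mlieBracket_add_right hU hp (hb hZ.1 hV.2) (hb hZ.2 hV.1),
    mlieBracket_sub_left hU hp (hb hZ.1 hW.1) (hb hZ.2 hW.2),
    mlieBracket_sub_left hU hp (hb hZ.1 hW.1) (hb hZ.2 hW.2),
    mlieBracket_add_left hU hp (hb hZ.1 hW.2) (hb hZ.2 hW.1),
    mlieBracket_add_left hU hp (hb hZ.1 hW.2) (hb hZ.2 hW.1),
    jacobi_mlieBracket hU hp hZ.1 hW.1 hV.1, jacobi_mlieBracket hU hp hZ.1 hW.2 hV.2,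
    jacobi_mlieBracket hU hp hZ.2 hW.1 hV.2, jacobi_mlieBracket hU hp hZ.2 hW.2 hV.1,
    jacobi_mlieBracket hU hp hZ.2 hW.1 hV.1, jacobi_mlieBracket hU hp hZ.2 hW.2 hV.2,
    jacobi_mlieBracket hU hp hZ.1 hW.1 hV.2, jacobi_mlieBracket hU hp hZ.1 hW.2 hV.1]
  simp only [map_add, map_sub]
  ring

theorem mlieBracket_neg_right {X Y : (p : M) → TangentSpace (𝓡 (2 * n + 1)) p} (hU : IsOpen U)
    (hp : p ∈ U) (hY : SmoothFieldOn Y U) :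
    VectorField.mlieBracket (𝓡 (2 * n + 1)) X (fun q => -Y q) p
      = -VectorField.mlieBracket (𝓡 (2 * n + 1)) X Y p := by
  have e : (fun q => -Y q) = (-1 : ℝ) • Y := by ext q; simp
  rw [e, VectorField.mlieBracket_const_smul_right (hY.mdifferentiableAt hU hp)]
  simp

theorem mlieBracket_neg_left {X Y : (p : M) → TangentSpace (𝓡 (2 * n + 1)) p} (hU : IsOpen U)
    (hp : p ∈ U) (hY : SmoothFieldOn Y U) :
    VectorField.mlieBracket (𝓡 (2 * n + 1)) (fun q => -Y q) X p
      = -VectorField.mlieBracket (𝓡 (2 * n + 1)) Y X p := by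
  rw [VectorField.mlieBracket_swap_apply, mlieBracket_neg_right hU hp hY,
    VectorField.mlieBracket_swap_apply (V := Y)]

theorem CForm.ap_bracket_conj (φ : CForm n M) {Z W : CField n M} (hU : IsOpen U) (hp : p ∈ U)
    (hZ : Z.SmoothOn U) (hW : W.SmoothOn U) :
    φ.ap (Z.conj.bracket W.conj) p = φ.ap (Z.bracket W).conj p := by
  simp only [CForm.ap, CField.bracket, CField.conj]
  rw [mlieBracket_neg_right hU hp hW.2, mlieBracket_neg_right hU hp hW.2,
    mlieBracket_neg_left hU hp hZ.2, mlieBracket_neg_left hU hp hZ.2]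
  simp only [map_add, map_sub, map_neg]
  ring

/-- The bracket with a linear combination of fields with smooth coefficients. -/
theorem CForm.ap_bracket_sum (φ : CForm n M) {ι : Type*} [Fintype ι] (hU : IsOpen U) (hp : p ∈ U)
    (Z : CField n M) {W : CField n M} {e : ι → CField n M} {f : ι → M → ℂ}
    (he : ∀ k, (e k).SmoothOn U) (hf : ∀ k, SmoothFunOn n (f k) U)
    (hre : ∀ q ∈ U, W.re q = ∑ k, ((f k q).re • (e k).re q + -(f k q).im • (e k).im q))
    (him : ∀ q ∈ U, W.im q = ∑ k, ((f k q).re • (e k).im q + (f k q).im • (e k).re q)) :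
    φ.ap (Z.bracket W) p
      = ∑ k, (Z.D (f k) p * φ.ap (e k) p + f k p * φ.ap (Z.bracket (e k)) p) := by
  have hfr := fun k => contMDiffOn_re (hf k)
  have hfi := fun k => contMDiffOn_im (hf k)
  have hfn : ∀ k, ContMDiffOn (𝓡 (2 * n + 1)) 𝓘(ℝ, ℝ) ∞ (fun q => -(f k q).im) U :=
    fun k => (hfi k).neg
  -- The hypotheses `hre`, `him` are the real and imaginary parts of `W = ∑ f_k e_k`. The formula is
  -- shown for a single real field `X`, then used for `Z.re` and `Z.im`, which recombine complex
  -- linearly.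
  have real : ∀ X : (p : M) → TangentSpace (𝓡 (2 * n + 1)) p,
      φ p (VectorField.mlieBracket (𝓡 (2 * n + 1)) X W.re p)
        + Complex.I * φ p (VectorField.mlieBracket (𝓡 (2 * n + 1)) X W.im p)
      = ∑ k, (dirDeriv X (f k) p * φ.ap (e k) p
        + f k p * (φ p (VectorField.mlieBracket (𝓡 (2 * n + 1)) X (e k).re p)
        + Complex.I * φ p (VectorField.mlieBracket (𝓡 (2 * n + 1)) X (e k).im p))) := by
    intro X
    rw [mlieBracket_congr_on hU hp (fun _ _ => rfl) hre,
      mlieBracket_congr_on hU hp (fun _ _ => rfl) him,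
      mlieBracket_sum_smul_add_smul_right hU hp hfr hfn (fun k => (he k).1) (fun k => (he k).2),
      mlieBracket_sum_smul_add_smul_right hU hp hfr hfi (fun k => (he k).2) (fun k => (he k).1),
      map_sum, map_sum, Finset.mul_sum, ← Finset.sum_add_distrib]
    refine Finset.sum_congr rfl fun k _ => ?_
    rw [dirDeriv_eq_re_im X ((hf k).mdifferentiableAt hU hp)]
    have hn : mvfderiv (𝓡 (2 * n + 1)) (fun q => -(f k q).im) p (X p)
        = -mvfderiv (𝓡 (2 * n + 1)) (fun q => (f k q).im) p (X p) := by
      rw [mvfderiv_fun_neg]; rfl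
    rw [hn]
    have hfk : f k p = ((f k p).re : ℂ) + (f k p).im * Complex.I := (Complex.re_add_im _).symm
    simp only [map_add, map_smul, CForm.ap, Complex.real_smul, neg_smul, map_neg]
    linear_combination -(mvfderiv (𝓡 (2 * n + 1)) (fun q => (f k q).im) p (X p)
      * φ p ((e k).im p) + (f k p).im
      * φ p (VectorField.mlieBracket (𝓡 (2 * n + 1)) X (e k).im p)) * Complex.I_sq
      - (φ p (VectorField.mlieBracket (𝓡 (2 * n + 1)) X (e k).re p)
      + Complex.I * φ p (VectorField.mlieBracket (𝓡 (2 * n + 1)) X (e k).im p)) * hfk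
  have h1 := real Z.re
  have h2 := real Z.im
  have : φ.ap (Z.bracket W) p
      = (φ p (VectorField.mlieBracket (𝓡 (2 * n + 1)) Z.re W.re p)
        + Complex.I * φ p (VectorField.mlieBracket (𝓡 (2 * n + 1)) Z.re W.im p))
      + Complex.I * (φ p (VectorField.mlieBracket (𝓡 (2 * n + 1)) Z.im W.re p)
        + Complex.I * φ p (VectorField.mlieBracket (𝓡 (2 * n + 1)) Z.im W.im p)) := by
    simp only [CForm.ap, CField.bracket, map_add, map_sub]
    linear_combination -φ p (VectorField.mlieBracket (𝓡 (2 * n + 1)) Z.im W.im p) * Complex.I_sq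
  rw [this, h1, h2, Finset.mul_sum, ← Finset.sum_add_distrib]
  refine Finset.sum_congr rfl fun k _ => ?_
  simp only [CForm.ap, CField.bracket, map_add, map_sub, CField.D_eq]
  linear_combination f k p * φ p (VectorField.mlieBracket (𝓡 (2 * n + 1)) Z.im (e k).im p)
    * Complex.I_sq

end SmoothComplexFields

theorem conj_complexify {n : ℕ} {M : Type u} [TopologicalSpace M] [ChartedSpace (Model n) M]
    (θ : (p : M) → TangentSpace (𝓡 (2 * n + 1)) p →L[ℝ] ℝ) :
    CForm.conj (complexify θ) = complexify θ := by
  funext p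
  ext v
  simp [CForm.conj, complexify]

/-- A real-linear map applied to the real and imaginary part of a complex linear combination. -/
theorem clm_sum_smul {E ι : Type*} [AddCommGroup E] [Module ℝ E] [TopologicalSpace E] [Fintype ι]
    (L : E →L[ℝ] ℂ) (w : ι → ℂ) (x y : ι → E) :
    L (∑ k, ((w k).re • x k + -(w k).im • y k))
      + Complex.I * L (∑ k, ((w k).re • y k + (w k).im • x k))
      = ∑ k, w k * (L (x k) + Complex.I * L (y k)) := by
  rw [map_sum, map_sum, Finset.mul_sum, ← Finset.sum_add_distrib]
  refine Finset.sum_congr rfl fun k _ => ?_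
  have hw : w k = ((w k).re : ℂ) + (w k).im * Complex.I := (Complex.re_add_im _).symm
  simp only [map_add, map_smul, Complex.real_smul, neg_smul, map_neg]
  linear_combination -((w k).im * L (y k)) * Complex.I_sq
    - (L (x k) + Complex.I * L (y k)) * hw

/-! ### The admissible frame as a basis -/

namespace AdmissibleFrame

open FrameIndex

variable {n : ℕ} {M : Type u} [TopologicalSpace M] [ChartedSpace (Model n) M]
  [IsManifold (𝓡 (2 * n + 1)) ∞ M] {S : Pseudohermitian n M} {U : Set M}
  (F : AdmissibleFrame S U) {p : M}

/-- The fields `T, Z_α, Z_{ᾱ}` of the frame. -/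
def field : FrameIndex n → CField n M := Sum.elim (fun _ => F.T) (Sum.elim F.Z F.Zbar)

/-- The forms `θ, θ^α, θ^{ᾱ}` of the coframe. -/
def coform : FrameIndex n → CForm n M :=
  Sum.elim (fun _ => complexify S.θ) (Sum.elim F.ϑ fun a => CForm.conj (F.ϑ a))

/-- The structure functions of the frame. -/
def structFun (i j k : FrameIndex n) (p : M) : ℂ :=
  (F.coform k).ap ((F.field i).bracket (F.field j)) p

@[simp] theorem field_t : F.field t = F.T := rfl
@[simp] theorem field_z (a : Fin n) : F.field (z a) = F.Z a := rfl
@[simp] theorem field_zb (a : Fin n) : F.field (zb a) = F.Zbar a := rfl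
@[simp] theorem coform_t : F.coform t = complexify S.θ := rfl
@[simp] theorem coform_z (a : Fin n) : F.coform (z a) = F.ϑ a := rfl
@[simp] theorem coform_zb (a : Fin n) : F.coform (zb a) = CForm.conj (F.ϑ a) := rfl

theorem field_bar (i : FrameIndex n) : F.field (bar i) = (F.field i).conj := by
  rcases i with ⟨⟨⟩⟩ | a | a
  · simp [T, CField.conj, CField.ofReal]
  · rfl
  · exact (CField.conj_conj _).symm

theorem coform_bar (i : FrameIndex n) : F.coform (bar i) = CForm.conj (F.coform i) := by
  rcases i with ⟨⟨⟩⟩ | a | a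
  · exact (conj_complexify S.θ).symm
  · rfl
  · exact (CForm.conj_conj _).symm

theorem field_smooth (i : FrameIndex n) : (F.field i).SmoothOn U := by
  rcases i with ⟨⟨⟩⟩ | a | a
  · exact ⟨F.reeb_smooth, smoothFieldOn_zero U⟩
  · exact F.Z_smooth a
  · exact (F.Z_smooth a).conj

theorem complexify_ap_smooth {Z : CField n M} (hZ : Z.SmoothOn U) (hU : IsOpen U) :
    SmoothFunOn n ((complexify S.θ).ap Z) U := by
  have h : ∀ X, SmoothFieldOn X U → SmoothFunOn n (fun p => (S.θ p (X p) : ℂ)) U := fun X hX =>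
    Complex.ofRealCLM.contDiff.contMDiff.comp_contMDiffOn (S.θ_smooth U hU X hX)
  exact (h _ hZ.1).add ((smoothFunOn_const Complex.I U).mul (h _ hZ.2))

theorem coform_ap_smooth (i : FrameIndex n) {Z : CField n M} (hZ : Z.SmoothOn U) :
    SmoothFunOn n ((F.coform i).ap Z) U := by
  have hϑ : ∀ (a : Fin n) {Z : CField n M}, Z.SmoothOn U → SmoothFunOn n ((F.ϑ a).ap Z) U := by
    intro a Z hZ
    have h : ∀ X, SmoothFieldOn X U → SmoothFunOn n (fun p => F.ϑ a p (X p)) U := fun X hX =>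
      F.ϑ_smooth a U F.isOpen subset_rfl X hX
    exact (h _ hZ.1).add ((smoothFunOn_const Complex.I U).mul (h _ hZ.2))
  rcases i with ⟨⟨⟩⟩ | a | a
  · exact complexify_ap_smooth hZ F.isOpen
  · exact hϑ a hZ
  · refine (hϑ a hZ.conj).conj.congr fun p _ => ?_
    rw [← CForm.conj_ap_conj, CField.conj_conj]
    rfl

theorem structFun_smooth (i j k : FrameIndex n) : SmoothFunOn n (F.structFun i j k) U :=
  F.coform_ap_smooth k ((F.field_smooth i).bracket F.isOpen (F.field_smooth j))

theorem θ_Z_re (a : Fin n) (hp : p ∈ U) : S.θ p ((F.Z a).re p) = 0 := (F.Z_oneZero a p hp).1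

theorem Z_im (a : Fin n) (hp : p ∈ U) : (F.Z a).im p = -S.J p ((F.Z a).re p) :=
  (F.Z_oneZero a p hp).2

theorem θ_Z_im (a : Fin n) (hp : p ∈ U) : S.θ p ((F.Z a).im p) = 0 := by
  rw [F.Z_im a hp, map_neg, S.J_mem p _ (F.θ_Z_re a hp), neg_zero]

theorem ϑ_Z_re (a b : Fin n) (hp : p ∈ U) :
    F.ϑ a p ((F.Z b).re p) = if a = b then 1 / 2 else 0 := by
  have h1 := F.ϑ_Z a b p hp
  have h2 := F.ϑ_conj_Z a b p hp
  simp only [CForm.ap, CField.conj, map_neg] at h1 h2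
  split_ifs at h1 ⊢ <;> linear_combination (h1 + h2) / 2

theorem ϑ_Z_im (a b : Fin n) (hp : p ∈ U) :
    F.ϑ a p ((F.Z b).im p) = if a = b then -Complex.I / 2 else 0 := by
  have h1 := F.ϑ_Z a b p hp
  have h2 := F.ϑ_conj_Z a b p hp
  simp only [CForm.ap, CField.conj, map_neg] at h1 h2
  split_ifs at h1 ⊢ <;>
  linear_combination -Complex.I * (h1 - h2) / 2 + F.ϑ a p ((F.Z b).im p) * Complex.I_sq

theorem coform_ap_field (i j : FrameIndex n) (hp : p ∈ U) :
    (F.coform i).ap (F.field j) p = if i = j then 1 else 0 := by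
  have hz : ∀ a, (F.coform (z a)).ap (F.field j) p = if z a = j then 1 else 0 := by
    intro a
    rcases j with ⟨⟨⟩⟩ | b | b
    · simpa [CForm.ap, T, CField.ofReal] using F.ϑ_reeb a p hp
    · simpa using F.ϑ_Z a b p hp
    · exact F.ϑ_conj_Z a b p hp
  rcases i with ⟨⟨⟩⟩ | a | a
  · rcases j with ⟨⟨⟩⟩ | b | b
    · simp [CForm.ap, T, CField.ofReal, complexify, F.θ_reeb p hp]
    · simp [CForm.ap, complexify, F.θ_Z_re b hp, F.θ_Z_im b hp]
    · simp [CForm.ap, complexify, F.θ_Z_re b hp, F.θ_Z_im b hp, Zbar, CField.conj]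
  · exact hz a
  · rcases j with ⟨⟨⟩⟩ | b | b
    · simp [CForm.ap, T, CField.ofReal, CForm.conj, F.ϑ_reeb a p hp]
    · have := CForm.conj_ap_conj (F.ϑ a) (F.Zbar b) p
      rw [Zbar, CField.conj_conj, F.ϑ_conj_Z a b p hp, map_zero] at this
      simpa using this
    · have := CForm.conj_ap_conj (F.ϑ a) (F.Z b) p
      rw [F.ϑ_Z a b p hp] at this
      simpa [apply_ite (starRingEnd ℂ), Zbar] using this

/-- A tangent vector on which all forms of the coframe vanish is zero. -/
theorem eq_zero_of_forms (hp : p ∈ U) (v : TangentSpace (𝓡 (2 * n + 1)) p) (h0 : S.θ p v = 0)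
    (h : ∀ a, F.ϑ a p v = 0) : v = 0 := by
  -- The forms `θ, θ^α` define a real-linear map to `ℝ × ℂⁿ`. Both sides have real dimension `2n +
  -- 1`, so injectivity follows from surjectivity.
  let Φ : TangentSpace (𝓡 (2 * n + 1)) p →ₗ[ℝ] ℝ × (Fin n → ℂ) :=
    (S.θ p).toLinearMap.prod (LinearMap.pi fun a => (F.ϑ a p).toLinearMap)
  have hsurj : Function.Surjective Φ := by
    rintro ⟨s, w⟩
    -- Since `θ^a(Re Z_a) = 1/2` and `θ^a(Im Z_a) = -i/2`, the coefficients `2 Re w_a` and `-2 Im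
    -- w_a` produce exactly `w_a`.
    refine ⟨s • F.reeb p + ∑ a, ((2 * (w a).re) • (F.Z a).re p - (2 * (w a).im) • (F.Z a).im p),
      Prod.ext ?_ ?_⟩
    · simp [Φ, F.θ_reeb p hp, F.θ_Z_re _ hp, F.θ_Z_im _ hp]
    · funext b
      have hw : w b = ((w b).re : ℂ) + (w b).im * Complex.I := (Complex.re_add_im _).symm
      have : F.ϑ b p (∑ a, ((2 * (w a).re) • (F.Z a).re p - (2 * (w a).im) • (F.Z a).im p))
          = w b := by
        rw [map_sum, Finset.sum_eq_single b]
        · rw [map_sub, map_smul, map_smul, F.ϑ_Z_re b b hp, F.ϑ_Z_im b b hp, if_pos rfl,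
            if_pos rfl, Complex.real_smul, Complex.real_smul]
          push_cast
          linear_combination -hw
        · intro a _ hab
          rw [map_sub, map_smul, map_smul, F.ϑ_Z_re b a hp, F.ϑ_Z_im b a hp, if_neg hab.symm,
            if_neg hab.symm, smul_zero, smul_zero, sub_zero]
        · simp
      change F.ϑ b p (s • F.reeb p
        + ∑ a, ((2 * (w a).re) • (F.Z a).re p - (2 * (w a).im) • (F.Z a).im p)) = w b
      rw [map_add, this, map_smul, F.ϑ_reeb b p hp, smul_zero, zero_add]
  have hfin : Module.finrank ℝ (TangentSpace (𝓡 (2 * n + 1)) p)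
      = Module.finrank ℝ (ℝ × (Fin n → ℂ)) := by
    rw [Module.finrank_prod, Module.finrank_pi_fintype]
    have : Module.finrank ℝ (TangentSpace (𝓡 (2 * n + 1)) p) = 2 * n + 1 :=
      finrank_euclideanSpace_fin
    simp [this, Complex.finrank_real_complex]
    ring
  have : FiniteDimensional ℝ (TangentSpace (𝓡 (2 * n + 1)) p) :=
    inferInstanceAs (FiniteDimensional ℝ (EuclideanSpace ℝ (Fin (2 * n + 1))))
  have hinj := (LinearMap.injective_iff_surjective_of_finrank_eq_finrank hfin).2 hsurj
  apply hinj
  rw [map_zero]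
  exact Prod.ext h0 (funext h)

/-- The difference `r + i s` of the two sides is annihilated by the whole coframe. As `θ^α` and its
conjugate both annihilate it, and `θ` is real, `r` and `s` are annihilated separately and vanish by
`eq_zero_of_forms`. The statement is pointwise, so `W` may be arbitrary. -/
theorem expand (W : CField n M) (hp : p ∈ U) :
    W.re p = ∑ k, (((F.coform k).ap W p).re • (F.field k).re p
        + -((F.coform k).ap W p).im • (F.field k).im p) ∧
    W.im p = ∑ k, (((F.coform k).ap W p).re • (F.field k).im p
        + ((F.coform k).ap W p).im • (F.field k).re p) := by
  set r := W.re p - ∑ k, (((F.coform k).ap W p).re • (F.field k).re p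
        + -((F.coform k).ap W p).im • (F.field k).im p) with hr
  set s := W.im p - ∑ k, (((F.coform k).ap W p).re • (F.field k).im p
        + ((F.coform k).ap W p).im • (F.field k).re p) with hs
  have key : ∀ l, F.coform l p r + Complex.I * F.coform l p s = 0 := by
    intro l
    have h1 : F.coform l p r + Complex.I * F.coform l p s = (F.coform l).ap W p
        - ∑ k, (F.coform k).ap W p * (F.coform l).ap (F.field k) p := by
      have := clm_sum_smul (F.coform l p) (fun k => (F.coform k).ap W p)
        (fun k => (F.field k).re p) (fun k => (F.field k).im p)
      rw [hr, hs, map_sub, map_sub]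
      simp only [CForm.ap] at this ⊢
      linear_combination -this
    rw [h1]
    simp [F.coform_ap_field _ _ hp]
  have hϑ : ∀ a, F.ϑ a p r = 0 ∧ F.ϑ a p s = 0 := by
    intro a
    have h1 : F.ϑ a p r + Complex.I * F.ϑ a p s = 0 := key (z a)
    have h2 : starRingEnd ℂ (F.ϑ a p r) + Complex.I * starRingEnd ℂ (F.ϑ a p s) = 0 := key (zb a)
    have h3 := congrArg (starRingEnd ℂ) h2
    simp only [map_add, map_mul, Complex.conj_conj, Complex.conj_I, map_zero] at h3
    refine ⟨by linear_combination (h1 + h3) / 2, ?_⟩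
    linear_combination -Complex.I * (h1 - h3) / 2 + F.ϑ a p s * Complex.I_sq
  have hθ : (S.θ p r : ℂ) + Complex.I * (S.θ p s : ℂ) = 0 := key t
  have hθr : S.θ p r = 0 := by simpa using congrArg Complex.re hθ
  have hθs : S.θ p s = 0 := by simpa using congrArg Complex.im hθ
  have hr0 : r = 0 := F.eq_zero_of_forms hp r hθr fun a => (hϑ a).1
  have hs0 : s = 0 := F.eq_zero_of_forms hp s hθs fun a => (hϑ a).2
  exact ⟨sub_eq_zero.1 hr0, sub_eq_zero.1 hs0⟩

/-- A real-linear map, extended to complex fields, in terms of the frame. -/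
theorem clm_expand (W : CField n M) (hp : p ∈ U)
    (L : TangentSpace (𝓡 (2 * n + 1)) p →L[ℝ] ℂ) :
    L (W.re p) + Complex.I * L (W.im p) = ∑ k, (F.coform k).ap W p
      * (L ((F.field k).re p) + Complex.I * L ((F.field k).im p)) := by
  obtain ⟨h1, h2⟩ := F.expand W hp
  have := clm_sum_smul L (fun k => (F.coform k).ap W p)
    (fun k => (F.field k).re p) (fun k => (F.field k).im p)
  rwa [← h1, ← h2] at this

theorem ap_expand (φ : CForm n M) (W : CField n M) (hp : p ∈ U) :
    φ.ap W p = ∑ k, (F.coform k).ap W p * φ.ap (F.field k) p :=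
  F.clm_expand W hp (φ p)

theorem D_expand (f : M → ℂ) (W : CField n M) (hp : p ∈ U) :
    W.D f p = ∑ k, (F.coform k).ap W p * (F.field k).D f p :=
  F.clm_expand W hp (mvfderiv (𝓡 (2 * n + 1)) f p)

theorem reeb_ne_zero (hp : p ∈ U) : F.reeb p ≠ 0 := by
  intro h
  have := F.θ_reeb p hp
  rw [h, map_zero] at this
  exact zero_ne_one this

/-! ### The structure functions -/

theorem structFun_self (i k : FrameIndex n) (p : M) : F.structFun i i k p = 0 := by
  have := (F.field i).bracket_swap (F.field i) (F.coform k) p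
  exact self_eq_neg.1 this

theorem structFun_antisymm (i j k : FrameIndex n) (p : M) :
    F.structFun i j k p = -F.structFun j i k p :=
  (F.field i).bracket_swap (F.field j) (F.coform k) p

theorem structFun_bar (i j k : FrameIndex n) (hp : p ∈ U) :
    F.structFun (bar i) (bar j) (bar k) p = starRingEnd ℂ (F.structFun i j k p) := by
  rw [structFun, field_bar, field_bar, coform_bar,
    CForm.ap_bracket_conj _ F.isOpen hp (F.field_smooth i) (F.field_smooth j),
    CForm.conj_ap_conj]
  rfl

theorem D_commutator {f : M → ℂ} (hf : SmoothFunOn n f U) (i j : FrameIndex n) (hp : p ∈ U) :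
    (F.field i).D ((F.field j).D f) p - (F.field j).D ((F.field i).D f) p
      = ∑ k, F.structFun i j k p * (F.field k).D f p := by
  -- The Reeb field serves as the auxiliary field that does not vanish at `p`.
  rw [← CField.D_bracket F.isOpen hp (F.field_smooth i) (F.field_smooth j) (F.field_smooth t)
    (F.reeb_ne_zero hp) hf]
  exact F.D_expand f _ hp

theorem extd_field (φ : CForm n M) (i j : FrameIndex n) (hp : p ∈ U) :
    φ.extd (F.field i) (F.field j) p
      = (F.field i).D (φ.ap (F.field j)) p - (F.field j).D (φ.ap (F.field i)) p
        - ∑ k, F.structFun i j k p * φ.ap (F.field k) p := by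
  rw [CForm.extd, F.ap_expand φ ((F.field i).bracket (F.field j)) hp]
  rfl

theorem structFun_jacobi (i j k l : FrameIndex n) (hp : p ∈ U) :
    (F.field i).D (F.structFun j k l) p + (F.field j).D (F.structFun k i l) p
      + (F.field k).D (F.structFun i j l) p
      + ∑ m, (F.structFun j k m p * F.structFun i m l p + F.structFun k i m p * F.structFun j m l p
        + F.structFun i j m p * F.structFun k m l p) = 0 := by
  -- An iterated bracket: `[e_j, e_k] = ∑ c_{jk}^m e_m` is inserted, and the Leibniz rule gives a
  -- derivative of `c` plus a quadratic term.
  have double : ∀ i j k : FrameIndex n, (F.coform l).ap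
      ((F.field i).bracket ((F.field j).bracket (F.field k))) p
      = (F.field i).D (F.structFun j k l) p
        + ∑ m, F.structFun j k m p * F.structFun i m l p := by
    intro i j k
    rw [CForm.ap_bracket_sum (F.coform l) F.isOpen hp (F.field i) (e := F.field)
      (f := fun m => F.structFun j k m) F.field_smooth (fun m => F.structFun_smooth j k m)
      (fun q hq => (F.expand _ hq).1) (fun q hq => (F.expand _ hq).2), Finset.sum_add_distrib]
    congr 1
    simp [F.coform_ap_field _ _ hp]
  have hJ := CForm.ap_jacobi (F.coform l) F.isOpen hp (F.field_smooth i) (F.field_smooth j)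
    (F.field_smooth k)
  rw [CField.bracket_swap ((F.field i).bracket (F.field j)), double, double, double] at hJ
  have hneg : (F.field j).D (F.structFun i k l) p = -(F.field j).D (F.structFun k i l) p := by
    rw [← CField.D_neg]
    exact congrArg (fun g => (F.field j).D g p) (funext fun q => F.structFun_antisymm i k l q)
  have hsum : ∑ m, F.structFun i k m p * F.structFun j m l p
      = -∑ m, F.structFun k i m p * F.structFun j m l p := by
    rw [← Finset.sum_neg_distrib]
    exact Finset.sum_congr rfl fun m _ => by rw [F.structFun_antisymm i k]; ring
  rw [hneg, hsum] at hJ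
  simp only [Finset.sum_add_distrib]
  linear_combination hJ

end AdmissibleFrame

/-! ### Integrability, the Reeb condition and positivity -/

namespace AdmissibleFrame

open FrameIndex

variable {n : ℕ} {M : Type u} [TopologicalSpace M] [ChartedSpace (Model n) M]
  [IsManifold (𝓡 (2 * n + 1)) ∞ M] {S : Pseudohermitian n M} {U : Set M}
  (F : AdmissibleFrame S U) {p : M}

/-- The forms `θ^α` are of type `(1,0)`. -/
theorem ϑ_J (hp : p ∈ U) (v : TangentSpace (𝓡 (2 * n + 1)) p) (hv : S.θ p v = 0) (a : Fin n) :
    F.ϑ a p (S.J p v) = Complex.I * F.ϑ a p v := by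
  have hre : ∀ b, F.ϑ a p (S.J p ((F.Z b).re p)) = Complex.I * F.ϑ a p ((F.Z b).re p) := by
    intro b
    rw [← neg_neg (S.J p _), ← F.Z_im b hp, map_neg, F.ϑ_Z_re a b hp, F.ϑ_Z_im a b hp]
    split_ifs <;> ring
  have him : ∀ b, F.ϑ a p (S.J p ((F.Z b).im p)) = Complex.I * F.ϑ a p ((F.Z b).im p) := by
    intro b
    rw [F.Z_im b hp, map_neg, S.J_sq p _ (F.θ_Z_re b hp), neg_neg, map_neg, hre]
    linear_combination F.ϑ a p ((F.Z b).re p) * Complex.I_sq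
  obtain ⟨c, hc, hvc⟩ : ∃ c : FrameIndex n → ℂ, c t = 0 ∧
      v = ∑ k, ((c k).re • (F.field k).re p + -(c k).im • (F.field k).im p) := by
    classical
    -- The vector `v` is extended by zero to a discontinuous field, which suffices because `expand`
    -- is pointwise.
    refine ⟨fun k => (F.coform k).ap (⟨Function.update 0 p v, 0⟩ : CField n M) p, ?_, ?_⟩
    · simp [CForm.ap, complexify, hv]
    · have := (F.expand (⟨Function.update 0 p v, 0⟩ : CField n M) hp).1
      simpa using this
  rw [hvc]
  simp only [map_sum, map_add, map_smul, Finset.mul_sum, mul_add]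
  refine Finset.sum_congr rfl fun k _ => ?_
  rcases k with ⟨⟨⟩⟩ | b | b
  · simp [hc]
  · simp only [field_z, hre, him, mul_smul_comm]
  · simp only [field_zb, Zbar, CField.conj, map_neg, hre, him, mul_smul_comm, mul_neg]

theorem structFun_z_z_t (a b : Fin n) (hp : p ∈ U) : F.structFun (z a) (z b) t p = 0 := by
  have h := S.integrable U F.isOpen (F.Z a) (F.Z b) (F.Z_smooth a) (F.Z_smooth b)
    (F.Z_oneZero a) (F.Z_oneZero b) p hp
  have him : S.θ p (((F.Z a).bracket (F.Z b)).im p) = 0 := by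
    rw [h.2, map_neg, S.J_mem p _ h.1, neg_zero]
  simp [structFun, CForm.ap, complexify, h.1, him]

/-- By integrability the bracket has the form `X - iJX` with `X` in `H` at `p`, and a form of type
`(0,1)` annihilates such vectors. -/
theorem structFun_z_z_zb (a b d : Fin n) (hp : p ∈ U) :
    F.structFun (z a) (z b) (zb d) p = 0 := by
  have h := S.integrable U F.isOpen (F.Z a) (F.Z b) (F.Z_smooth a) (F.Z_smooth b)
    (F.Z_oneZero a) (F.Z_oneZero b) p hp
  simp only [structFun, CForm.ap, field_z, coform_zb, h.2, CForm.conj, map_neg,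
    ContinuousLinearMap.comp_apply, F.ϑ_J hp _ h.1]
  simp [← mul_assoc]

/-- When `θ(X)` is constant, `dθ(T, X)` reduces to `-θ([T, X])`. -/
theorem θ_mlieBracket_reeb {X : (p : M) → TangentSpace (𝓡 (2 * n + 1)) p} {s : ℝ}
    (hX : SmoothFieldOn X U) (hs : ∀ q ∈ U, S.θ q (X q) = s) (hp : p ∈ U) :
    S.θ p (VectorField.mlieBracket (𝓡 (2 * n + 1)) F.reeb X p) = 0 := by
  have h := F.reeb_contract U F.isOpen subset_rfl X hX p hp
  rw [CForm.extd, CField.D_const_on _ F.isOpen (z := (s : ℂ)) _ hp,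
    CField.D_const_on _ F.isOpen (z := 1) _ hp] at h
  · have h0 : VectorField.mlieBracket (𝓡 (2 * n + 1)) (fun p =>
        (0 : TangentSpace (𝓡 (2 * n + 1)) p)) (fun p : M =>
        (0 : TangentSpace (𝓡 (2 * n + 1)) p)) p = 0 :=
      congrFun VectorField.mlieBracket_zero_right p
    have h1 : ∀ Y : (p : M) → TangentSpace (𝓡 (2 * n + 1)) p,
        VectorField.mlieBracket (𝓡 (2 * n + 1)) Y (fun p : M =>
        (0 : TangentSpace (𝓡 (2 * n + 1)) p)) p = 0 := fun Y =>
      congrFun VectorField.mlieBracket_zero_right p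
    have h2 : ∀ Y : (p : M) → TangentSpace (𝓡 (2 * n + 1)) p,
        VectorField.mlieBracket (𝓡 (2 * n + 1)) (fun p : M =>
        (0 : TangentSpace (𝓡 (2 * n + 1)) p)) Y p = 0 := fun Y =>
      congrFun VectorField.mlieBracket_zero_left p
    simpa [CForm.ap, CField.bracket, CField.ofReal, complexify, h0, h1, h2] using h
  · intro q hq; simp [CForm.ap, CField.ofReal, complexify, F.θ_reeb q hq]
  · intro q hq; simp [CForm.ap, CField.ofReal, complexify, hs q hq]

theorem structFun_t_t (i : FrameIndex n) (hp : p ∈ U) : F.structFun t i t p = 0 := by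
  have hs : ∃ s s' : ℝ, (∀ q ∈ U, S.θ q ((F.field i).re q) = s)
      ∧ ∀ q ∈ U, S.θ q ((F.field i).im q) = s' := by
    rcases i with ⟨⟨⟩⟩ | a | a
    · exact ⟨1, 0, F.θ_reeb, fun q _ => map_zero _⟩
    · exact ⟨0, 0, fun q hq => F.θ_Z_re a hq, fun q hq => F.θ_Z_im a hq⟩
    · refine ⟨0, 0, fun q hq => F.θ_Z_re a hq, fun q hq => ?_⟩
      change S.θ q (-(F.Z a).im q) = 0
      rw [map_neg, F.θ_Z_im a hq, neg_zero]
  obtain ⟨s, s', h1, h2⟩ := hs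
  have e1 := F.θ_mlieBracket_reeb (F.field_smooth i).1 h1 hp
  have e2 := F.θ_mlieBracket_reeb (F.field_smooth i).2 h2 hp
  have h0 : ∀ Y : (p : M) → TangentSpace (𝓡 (2 * n + 1)) p,
      VectorField.mlieBracket (𝓡 (2 * n + 1)) (fun p : M =>
      (0 : TangentSpace (𝓡 (2 * n + 1)) p)) Y p = 0 := fun Y =>
    congrFun VectorField.mlieBracket_zero_left p
  simp [structFun, CForm.ap, CField.bracket, T, CField.ofReal, complexify, e1, e2, h0]

/-- The Levi form in terms of the structure functions. -/
theorem h_eq (a b : Fin n) (hp : p ∈ U) :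
    F.h a b p = Complex.I * F.structFun (z a) (zb b) t p := by
  have h0 : ∀ i : FrameIndex n, i ≠ t → ∀ q ∈ U, (complexify S.θ).ap (F.field i) q = 0 :=
    fun i hi q hq => by
      have := F.coform_ap_field t i hq
      rwa [if_neg hi.symm] at this
  have h1 : ∀ q ∈ U, (complexify S.θ).ap (F.Z a) q = 0 := h0 (z a) (by simp)
  have h2 : ∀ q ∈ U, (complexify S.θ).ap (F.Zbar b) q = 0 := h0 (zb b) (by simp)
  rw [h, CForm.extd, CField.D_const_on _ F.isOpen h1 hp, CField.D_const_on _ F.isOpen h2 hp]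
  simp [structFun]

/-- The Levi form is positive definite. -/
theorem sum_h_pos (v : Fin n → ℂ) (hv : v ≠ 0) (hp : p ∈ U) :
    0 < (∑ a, ∑ b, v a * starRingEnd ℂ (v b) * F.h a b p).re := by
  -- Take `V = ∑ v_a Z_a` with constant coefficients and `X = Re V`, so that `JX = -Im V`. Then
  -- `θ([V, V̄]) = -2i θ([Re V, Im V])`, and the hermitian form equals `2 dθ(X, JX)`, positive by
  -- pseudoconvexity.
  let V : CField n M := ⟨fun q => ∑ a, ((v a).re • (F.Z a).re q + -(v a).im • (F.Z a).im q),
    fun q => ∑ a, ((v a).re • (F.Z a).im q + (v a).im • (F.Z a).re q)⟩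
  have hZ := F.Z_smooth
  have hV : V.SmoothOn U :=
    ⟨SmoothFieldOn.sum Finset.univ fun a => (SmoothFieldOn.smul (f := fun _ => (v a).re)
      contMDiffOn_const
        (hZ a).1).add (SmoothFieldOn.smul (f := fun _ => -(v a).im) contMDiffOn_const (hZ a).2),
      SmoothFieldOn.sum Finset.univ fun a => (SmoothFieldOn.smul (f := fun _ => (v a).re)
        contMDiffOn_const
        (hZ a).2).add (SmoothFieldOn.smul (f := fun _ => (v a).im) contMDiffOn_const (hZ a).1)⟩
  have hθre : ∀ q ∈ U, S.θ q (V.re q) = 0 := fun q hq => by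
    simp [V, F.θ_Z_re _ hq, F.θ_Z_im _ hq]
  have hθim : ∀ q ∈ U, S.θ q (V.im q) = 0 := fun q hq => by
    simp [V, F.θ_Z_re _ hq, F.θ_Z_im _ hq]
  have hJ : ∀ q ∈ U, S.J q (V.re q) = -V.im q := fun q hq => by
    have hJre : ∀ a, S.J q ((F.Z a).re q) = -(F.Z a).im q := fun a => by
      rw [F.Z_im a hq, neg_neg]
    have hJim : ∀ a, S.J q ((F.Z a).im q) = (F.Z a).re q := fun a => by
      rw [F.Z_im a hq, map_neg, S.J_sq q _ (F.θ_Z_re a hq), neg_neg]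
    simp only [V, map_sum, map_add, map_smul, hJre, hJim]
    rw [← Finset.sum_neg_distrib]
    refine Finset.sum_congr rfl fun a _ => ?_
    rw [smul_neg, neg_smul, neg_add]
  have hne : V.re p ≠ 0 := by
    intro h0
    apply hv
    funext b
    have h1 : F.ϑ b p (V.re p) = v b / 2 := by
      have hw : v b = ((v b).re : ℂ) + (v b).im * Complex.I := (Complex.re_add_im _).symm
      simp only [V]
      rw [map_sum, Finset.sum_eq_single b]
      · rw [map_add, map_smul, map_smul, F.ϑ_Z_re b b hp, F.ϑ_Z_im b b hp, if_pos rfl,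
          if_pos rfl, Complex.real_smul, Complex.real_smul]
        push_cast
        linear_combination -hw / 2
      · intro a _ hab
        rw [map_add, map_smul, map_smul, F.ϑ_Z_re b a hp, F.ϑ_Z_im b a hp, if_neg hab.symm,
          if_neg hab.symm, smul_zero, smul_zero, add_zero]
      · simp
    rw [h0, map_zero] at h1
    simpa using h1.symm
  have hpos := S.pseudoconvex U F.isOpen V.re hV.1 hθre p hp hne
  have hval : ((complexify S.θ).extd (CField.ofReal V.re)
      (CField.ofReal fun q => S.J q (V.re q)) p).re
      = S.θ p (VectorField.mlieBracket (𝓡 (2 * n + 1)) V.re V.im p) := by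
    have e1 : VectorField.mlieBracket (𝓡 (2 * n + 1)) V.re (fun q => S.J q (V.re q)) p
        = -VectorField.mlieBracket (𝓡 (2 * n + 1)) V.re V.im p := by
      rw [mlieBracket_congr_on F.isOpen hp (fun _ _ => rfl) hJ,
        mlieBracket_neg_right F.isOpen hp hV.2]
    have h1 : ∀ Y : (p : M) → TangentSpace (𝓡 (2 * n + 1)) p,
        VectorField.mlieBracket (𝓡 (2 * n + 1)) Y (fun p : M =>
        (0 : TangentSpace (𝓡 (2 * n + 1)) p)) p = 0 := fun Y =>
      congrFun VectorField.mlieBracket_zero_right p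
    have h2 : ∀ Y : (p : M) → TangentSpace (𝓡 (2 * n + 1)) p,
        VectorField.mlieBracket (𝓡 (2 * n + 1)) (fun p : M =>
        (0 : TangentSpace (𝓡 (2 * n + 1)) p)) Y p = 0 := fun Y =>
      congrFun VectorField.mlieBracket_zero_left p
    rw [CForm.extd, CField.D_const_on _ F.isOpen (z := 0) _ hp,
      CField.D_const_on _ F.isOpen (z := 0) _ hp]
    · simp [CForm.ap, CField.bracket, CField.ofReal, complexify, h1, h2, e1]
    · intro q hq; simp [CForm.ap, CField.ofReal, complexify, hθre q hq]
    · intro q hq; simp [CForm.ap, CField.ofReal, complexify, hJ q hq, hθim q hq]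
  have hbr : (complexify S.θ).ap (V.bracket V.conj) p
      = -2 * Complex.I * S.θ p (VectorField.mlieBracket (𝓡 (2 * n + 1)) V.re V.im p) := by
    have hself : ∀ Y : (p : M) → TangentSpace (𝓡 (2 * n + 1)) p,
        VectorField.mlieBracket (𝓡 (2 * n + 1)) Y Y p = 0 := fun Y => by simp
    simp only [CForm.ap, CField.bracket, CField.conj]
    rw [mlieBracket_neg_right F.isOpen hp hV.2, mlieBracket_neg_right F.isOpen hp hV.2,
      hself, hself, VectorField.mlieBracket_swap_apply (V := V.im) (W := V.re)]
    simp only [neg_zero, sub_zero, map_zero, zero_add, map_add, map_neg, complexify,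
      ContinuousLinearMap.comp_apply, Complex.ofRealCLM_apply]
    ring
  have hsum : (complexify S.θ).ap (V.bracket V.conj) p
      = -Complex.I * ∑ a, ∑ b, v a * starRingEnd ℂ (v b) * F.h a b p := by
    have hs := fun z => smoothFunOn_const (n := n) (M := M) z U
    have h1 : ∀ b, (complexify S.θ).ap (V.bracket (F.Zbar b)) p
        = ∑ a, v a * (-Complex.I * F.h a b p) := by
      intro b
      rw [CField.bracket_swap, CForm.ap_bracket_sum (complexify S.θ) F.isOpen hp (F.Zbar b)
        (W := V) (e := F.Z) (f := fun a _ => v a) hZ (fun a => hs _) (fun _ _ => rfl)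
        (fun _ _ => rfl), ← Finset.sum_neg_distrib]
      refine Finset.sum_congr rfl fun a _ => ?_
      rw [CField.D_const, CField.bracket_swap, F.h_eq a b hp, structFun]
      simp only [field_z, field_zb, coform_t]
      linear_combination v a * (complexify S.θ).ap ((F.Z a).bracket (F.Zbar b)) p * Complex.I_sq
    rw [CForm.ap_bracket_sum (complexify S.θ) F.isOpen hp V (W := V.conj) (e := F.Zbar)
      (f := fun b _ => starRingEnd ℂ (v b)) (fun b => (hZ b).conj) (fun b => hs _)]
    · simp only [CField.D_const, h1, zero_mul, zero_add, Finset.mul_sum]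
      rw [Finset.sum_comm]
      exact Finset.sum_congr rfl fun _ _ => Finset.sum_congr rfl fun _ _ => by ring
    · intro q _
      change ∑ a, ((v a).re • (F.Z a).re q + -(v a).im • (F.Z a).im q) = _
      exact Finset.sum_congr rfl fun a _ => by simp [Zbar, CField.conj]
    · intro q _
      change -∑ a, ((v a).re • (F.Z a).im q + (v a).im • (F.Z a).re q) = _
      rw [← Finset.sum_neg_distrib]
      exact Finset.sum_congr rfl fun a _ => by simp [Zbar, CField.conj]; abel
  rw [hval] at hpos
  have : ∑ a, ∑ b, v a * starRingEnd ℂ (v b) * F.h a b p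
      = ((2 * S.θ p (VectorField.mlieBracket (𝓡 (2 * n + 1)) V.re V.im p) : ℝ) : ℂ) := by
    rw [hsum] at hbr
    push_cast
    linear_combination Complex.I * hbr + (∑ a, ∑ b, v a * starRingEnd ℂ (v b) * F.h a b p
      - 2 * S.θ p (VectorField.mlieBracket (𝓡 (2 * n + 1)) V.re V.im p)) * Complex.I_sq
  rw [this, Complex.ofReal_re]
  linarith

/-- A null vector `w` of the matrix would contradict positivity on `w̄`; the conjugate enters
because the second argument is the conjugated one in `sum_h_pos`. -/
theorem isUnit_det_h (hp : p ∈ U) : IsUnit (Matrix.of fun a b => F.h a b p).det := by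
  rw [isUnit_iff_ne_zero]
  intro h0
  obtain ⟨w, hw, hw0⟩ := Matrix.exists_mulVec_eq_zero_iff.2 h0
  have hpos := F.sum_h_pos (fun a => starRingEnd ℂ (w a))
    (fun h => hw (funext fun a => by simpa using congrFun h a)) hp
  have : ∑ a, ∑ b, starRingEnd ℂ (w a) * starRingEnd ℂ (starRingEnd ℂ (w b)) * F.h a b p = 0 := by
    refine Finset.sum_eq_zero fun a _ => ?_
    have := congrFun hw0 a
    simp only [Matrix.mulVec, dotProduct, Matrix.of_apply, Pi.zero_apply] at this
    rw [← mul_zero (starRingEnd ℂ (w a)), ← this, Finset.mul_sum]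
    exact Finset.sum_congr rfl fun b _ => by rw [Complex.conj_conj]; ring
  rw [this] at hpos
  simp at hpos

end AdmissibleFrame

/-! ### The ring of smooth functions on an open set -/

section SmoothRing

variable {n : ℕ} {M : Type u} [TopologicalSpace M] [ChartedSpace (Model n) M]

/-- The ring of smooth functions on `U`. -/
def smoothRing (n : ℕ) {M : Type u} [TopologicalSpace M] [ChartedSpace (Model n) M]
    (U : Set M) : Subring (U → ℂ) where
  carrier := {g | ∃ f : M → ℂ, SmoothFunOn n f U ∧ ∀ p : U, g p = f p}
  mul_mem' := by
    rintro a b ⟨f, hf, h⟩ ⟨f', hf', h'⟩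
    exact ⟨_, hf.mul hf', fun p => by simp [h, h']⟩
  one_mem' := ⟨_, smoothFunOn_const 1 U, fun _ => rfl⟩
  add_mem' := by
    rintro a b ⟨f, hf, h⟩ ⟨f', hf', h'⟩
    exact ⟨_, hf.add hf', fun p => by simp [h, h']⟩
  zero_mem' := ⟨_, smoothFunOn_const 0 U, fun _ => rfl⟩
  neg_mem' := by
    rintro a ⟨f, hf, h⟩
    exact ⟨_, hf.neg, fun p => by simp [h]⟩

namespace smoothRing

variable {U : Set M}

/-- Evaluation at a point of `U`. -/
def eval (p : U) : smoothRing n U →+* ℂ :=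
  (Pi.evalRingHom (fun _ : U => ℂ) p).comp (Subring.subtype _)

theorem eval_ext {a b : smoothRing n U} (h : ∀ p, eval p a = eval p b) : a = b :=
  Subtype.ext (funext h)

/-- The restriction of a function smooth on `U`. -/
def restrict (f : M → ℂ) (hf : SmoothFunOn n f U) : smoothRing n U :=
  ⟨fun p => f p, f, hf, fun _ => rfl⟩

@[simp] theorem eval_restrict (f : M → ℂ) (hf : SmoothFunOn n f U) (p : U) :
    eval p (restrict f hf) = f p := rfl

theorem exists_eq_restrict (g : smoothRing n U) : ∃ f, ∃ hf : SmoothFunOn n f U,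
    g = restrict f hf := by
  obtain ⟨g, f, hf, h⟩ := g
  exact ⟨f, hf, Subtype.ext (funext h)⟩

theorem smoothFunOn_of_eval (g : smoothRing n U) {f : M → ℂ} (h : ∀ p : U, eval p g = f p) :
    SmoothFunOn n f U := by
  obtain ⟨f', hf', rfl⟩ := exists_eq_restrict g
  exact hf'.congr fun p hp => (h ⟨p, hp⟩).symm

/-- Complex conjugation. -/
def conj : smoothRing n U →+* smoothRing n U where
  toFun g := ⟨fun p => starRingEnd ℂ (g.1 p), by
    obtain ⟨g, f, hf, h⟩ := g
    exact ⟨_, hf.conj, fun p => by simp [h]⟩⟩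
  map_one' := by ext; simp
  map_mul' _ _ := by ext; simp
  map_zero' := by ext; simp
  map_add' _ _ := by ext; simp

@[simp] theorem eval_conj (g : smoothRing n U) (p : U) :
    eval p (conj g) = starRingEnd ℂ (eval p g) := rfl

variable [IsManifold (𝓡 (2 * n + 1)) ∞ M]

/-- A smooth complex vector field as a derivation. -/
def deriv (hU : IsOpen U) (Z : CField n M) (hZ : Z.SmoothOn U) :
    Derivation ℤ (smoothRing n U) (smoothRing n U) :=
  -- An element of the ring is only a function on `U`, so a function on `M` restricting to it is
  -- chosen. By `hD` the choice is irrelevant: on an open set the derivative depends only on the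
  -- values there.
  let D : smoothRing n U → smoothRing n U := fun g =>
    restrict (Z.D (exists_eq_restrict g).choose) ((exists_eq_restrict g).choose_spec.choose.D hU hZ)
  have hD : ∀ (f : M → ℂ) (hf : SmoothFunOn n f U),
      D (restrict f hf) = restrict (Z.D f) (hf.D hU hZ) := by
    intro f hf
    refine eval_ext fun p => Z.D_congr hU (fun q hq => ?_) p.2
    exact (congrArg (eval ⟨q, hq⟩)
      (exists_eq_restrict (restrict f hf)).choose_spec.choose_spec).symm
  Derivation.mk' (AddMonoidHom.mk' D fun a b => by
      obtain ⟨f, hf, rfl⟩ := exists_eq_restrict a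
      obtain ⟨g, hg, rfl⟩ := exists_eq_restrict b
      have : restrict f hf + restrict g hg = restrict _ (hf.add hg) := rfl
      rw [this, hD, hD, hD]
      exact eval_ext fun p => Z.D_add hU hf hg p.2).toIntLinearMap
    fun a b => by
      obtain ⟨f, hf, rfl⟩ := exists_eq_restrict a
      obtain ⟨g, hg, rfl⟩ := exists_eq_restrict b
      have : restrict f hf * restrict g hg = restrict _ (hf.mul hg) := rfl
      change D _ = _ • D _ + _ • D _
      rw [this, hD, hD, hD]
      exact eval_ext fun p => Z.D_mul hU hf hg p.2

theorem eval_deriv (hU : IsOpen U) (Z : CField n M) (hZ : Z.SmoothOn U) (g : smoothRing n U)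
    {f : M → ℂ} (h : ∀ p : U, eval p g = f p) (p : U) :
    eval p (deriv hU Z hZ g) = Z.D f p := by
  refine Z.D_congr hU (fun q hq => ?_) p.2
  rw [← h ⟨q, hq⟩]
  exact (congrArg (eval ⟨q, hq⟩) (exists_eq_restrict g).choose_spec.choose_spec).symm

end smoothRing

end SmoothRing

/-! ### From the algebra back to the manifold -/

namespace AdmissibleFrame

open FrameIndex smoothRing

variable {n : ℕ} {M : Type u} [TopologicalSpace M] [ChartedSpace (Model n) M]
  [IsManifold (𝓡 (2 * n + 1)) ∞ M] {S : Pseudohermitian n M} {U : Set M}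
  (F : AdmissibleFrame S U)

theorem h_smooth (a b : Fin n) : SmoothFunOn n (F.h a b) U :=
  ((smoothFunOn_const Complex.I U).mul (F.structFun_smooth (z a) (zb b) t)).congr
    fun _ hp => F.h_eq a b hp

/-- Cramer's rule: the determinant and the adjugate are polynomial in the smooth functions `h`, and
the determinant has no zero on `U`. -/
theorem hInv_smooth (a b : Fin n) : SmoothFunOn n (F.hInv a b) U := by
  let H : Matrix (Fin n) (Fin n) (smoothRing n U) :=
    Matrix.of fun a b => restrict _ (F.h_smooth a b)
  have hH : ∀ p : U, (eval p).mapMatrix H = Matrix.of fun a b => F.h a b p := fun p => rfl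
  obtain ⟨d, hd, hd'⟩ := exists_eq_restrict H.det
  obtain ⟨f, hf, hf'⟩ := exists_eq_restrict (H.adjugate b a)
  have hdet : ∀ p (hp : p ∈ U), d p = (Matrix.of fun a b => F.h a b p).det := fun p hp => by
    rw [← hH ⟨p, hp⟩, ← RingHom.map_det, hd']; rfl
  have hadj : ∀ p (hp : p ∈ U), f p = (Matrix.of fun a b => F.h a b p).adjugate b a :=
    fun p hp => by
      rw [← hH ⟨p, hp⟩, ← RingHom.map_adjugate, RingHom.mapMatrix_apply, Matrix.map_apply, hf']
      rfl
  refine ((hd.inv fun p hp => ?_).mul hf).congr fun p hp => ?_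
  · rw [hdet p hp]; exact (F.isUnit_det_h hp).ne_zero
  · rw [hdet p hp, hadj p hp, hInv, Matrix.inv_def, Ring.inverse_eq_inv', Matrix.smul_apply,
      smul_eq_mul]

theorem sum_hInv_mul_h (a g : Fin n) {p : M} (hp : p ∈ U) :
    ∑ b, F.hInv a b p * F.h g b p = if a = g then 1 else 0 := by
  have h1 := congrFun (congrFun (Matrix.mul_nonsing_inv _ (F.isUnit_det_h hp)) g) a
  rw [Matrix.mul_apply, Matrix.one_apply] at h1
  simp only [eq_comm (a := a), ← h1]
  exact Finset.sum_congr rfl fun b _ => mul_comm _ _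

/-- The structure functions of an admissible frame, in the ring of smooth functions. -/
def structureFunctions : CRStructureFunctions n (smoothRing n U) where
  E i := smoothRing.deriv F.isOpen (F.field i) (F.field_smooth i)
  c i j k := restrict _ (F.structFun_smooth i j k)
  c_self i k := eval_ext fun p => F.structFun_self i k p
  antisymm i j k := eval_ext fun p => F.structFun_antisymm i j k p
  comm i j g := by
    obtain ⟨f, hf, rfl⟩ := exists_eq_restrict g
    refine eval_ext fun p => ?_
    have h : ∀ i (q : U), eval q (smoothRing.deriv F.isOpen (F.field i) (F.field_smooth i)
        (restrict f hf))
        = (F.field i).D f q := fun i q => eval_deriv _ _ _ _ (fun _ => rfl) q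
    simp only [map_sub, map_sum, map_mul, eval_deriv _ _ _ _ (h _), h, eval_restrict]
    exact F.D_commutator hf i j p.2
  jacobi i j k l := by
    refine eval_ext fun p => ?_
    simp only [map_add, map_sum, map_mul, eval_deriv _ _ _ (restrict _ _) (fun _ => rfl),
      eval_restrict,
      map_zero]
    exact F.structFun_jacobi i j k l p.2
  conj := smoothRing.conj
  I := restrict _ (smoothFunOn_const Complex.I U)
  hInv a b := restrict _ (F.hInv_smooth a b)
  conj_conj g := eval_ext fun p => by simp
  I_mul_I := eval_ext fun p => by simp
  conj_I := eval_ext fun p => by simp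
  E_I i := eval_ext fun p => by
    rw [eval_deriv _ _ _ (restrict _ _) (fun _ => rfl), CField.D_const, map_zero]
  E_conj i g := by
    obtain ⟨f, hf, rfl⟩ := exists_eq_restrict g
    refine eval_ext fun p => ?_
    rw [eval_conj, eval_deriv _ _ _ (restrict f hf) (fun _ => rfl),
      eval_deriv (f := fun q => starRingEnd ℂ (f q)) _ _ _ _ (fun _ => rfl), ← CField.D_conj]
    rw [field_bar]
  c_conj i j k := eval_ext fun p => F.structFun_bar i j k p.2
  c_z_z_t a b := eval_ext fun p => F.structFun_z_z_t a b p.2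
  c_z_z_zb a b d := eval_ext fun p => F.structFun_z_z_zb a b d p.2
  c_t_t i := eval_ext fun p => F.structFun_t_t i p.2
  sum_hInv_mul a g := eval_ext fun p => by
    have := F.sum_hInv_mul_h a g p.2
    simp only [map_sum, map_mul, eval_restrict, apply_ite (eval p), map_one, map_zero]
    rw [← this]
    exact Finset.sum_congr rfl fun b _ => by rw [F.h_eq g b p.2]

theorem eval_E (i : FrameIndex n) {g : smoothRing n U} {f : M → ℂ} (h : ∀ p : U, eval p g = f p)
    (p : U) : eval p (F.structureFunctions.E i g) = (F.field i).D f p :=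
  eval_deriv F.isOpen (F.field i) (F.field_smooth i) g h p

theorem eval_hInv (a b : Fin n) (p : U) :
    eval p (F.structureFunctions.hInv a b) = F.hInv a b p := rfl

theorem eval_structureFunctions_conj (g : smoothRing n U) (p : U) :
    eval p (F.structureFunctions.conj g) = starRingEnd ℂ (eval p g) := rfl

theorem eval_I (p : U) : eval p F.structureFunctions.I = Complex.I := rfl

theorem eval_h (a b : Fin n) (p : U) : eval p (F.structureFunctions.h a b) = F.h a b p := by
  rw [F.h_eq a b p.2]; rfl

theorem eval_connBar (g a b : Fin n) (p : U) :
    eval p (F.structureFunctions.connBar g a b) = F.connBar g a b p := rfl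

theorem eval_connHol (g a b : Fin n) (p : U) :
    eval p (F.structureFunctions.connHol g a b) = F.connHol g a b p := by
  simp only [CRStructureFunctions.connHol, map_sum, map_mul, map_sub, eval_hInv, eval_connBar,
    eval_structureFunctions_conj, eval_h, F.eval_E _ (F.eval_h _ _), connHol]
  rfl

theorem eval_torsion (a b : Fin n) (p : U) :
    eval p (F.structureFunctions.torsion a b) = F.A a b p := by
  simp only [CRStructureFunctions.torsion, map_sum, map_mul, map_neg, eval_h,
    eval_structureFunctions_conj, A]
  rfl

theorem conn_ap (a b : Fin n) (W : CField n M) (p : M) : (F.conn a b).ap W p =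
    ∑ g, (F.connHol g a b p * (F.ϑ g).ap W p + F.connBar g a b p * (CForm.conj (F.ϑ g)).ap W p)
      + F.connReeb a b p * (complexify S.θ).ap W p := by
  simp only [CForm.ap, conn, add_apply, sum_apply,
    smul_apply, smul_eq_mul, mul_add, Finset.sum_add_distrib, Finset.mul_sum]
  ring_nf

theorem conn_ap_T (a b : Fin n) {p : M} (hp : p ∈ U) :
    (F.conn a b).ap F.T p = F.connReeb a b p := by
  have h := fun i => F.coform_ap_field i t hp
  have h1 := fun g => h (z g)
  have h2 := fun g => h (zb g)
  have h3 := h t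
  simp only [coform_z, coform_zb, coform_t, field_t] at h1 h2 h3
  simp [conn_ap, h1, h2, h3]

theorem conn_ap_Z (g a b : Fin n) {p : M} (hp : p ∈ U) :
    (F.conn a b).ap (F.Z g) p = F.connHol g a b p := by
  have h := fun i => F.coform_ap_field i (z g) hp
  have h1 := fun g => h (z g)
  have h2 := fun g => h (zb g)
  have h3 := h t
  simp only [coform_z, coform_zb, coform_t, field_z] at h1 h2 h3
  simp [conn_ap, h1, h2, h3]

theorem conn_ap_Zbar (g a b : Fin n) {p : M} (hp : p ∈ U) :
    (F.conn a b).ap (F.Zbar g) p = F.connBar g a b p := by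
  have h := fun i => F.coform_ap_field i (zb g) hp
  have h1 := fun g => h (z g)
  have h2 := fun g => h (zb g)
  have h3 := h t
  simp only [coform_z, coform_zb, coform_t, field_zb] at h1 h2 h3
  simp [conn_ap, h1, h2, h3]

theorem eval_divTorsion (a : Fin n) (p : U) :
    eval p (F.structureFunctions.divTorsion a) = F.divA a p := by
  simp only [CRStructureFunctions.divTorsion, map_sum, map_mul, map_sub, eval_hInv, eval_connBar,
    eval_torsion, F.eval_E _ (F.eval_torsion _ _), divA, nablaBarTwo, F.conn_ap_Zbar _ _ _ p.2]
  rfl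

theorem eval_ricci (a b : Fin n) (p : U) :
    eval p (F.structureFunctions.ricci a b) = F.ricci a b p := by
  -- The term `ω_γ^δ ∧ ω_δ^γ` has vanishing trace by antisymmetry of the wedge product, so Ricci is
  -- a component of `d ω_γ^γ`.
  have hw : ∑ g, ∑ d, CForm.wedge (F.conn g d) (F.conn d g) (F.Z a) (F.Zbar b) p = 0 := by
    simp only [CForm.wedge, Finset.sum_sub_distrib]
    rw [sub_eq_zero, Finset.sum_comm]
    exact Finset.sum_congr rfl fun _ _ => Finset.sum_congr rfl fun _ _ => mul_comm _ _
  have hs : F.ricci a b p = ∑ g, (F.conn g g).extd (F.Z a) (F.Zbar b) p := by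
    simp only [ricci, curv, curvForm, Finset.sum_sub_distrib, hw, sub_zero]
  let w : Fin n → FrameIndex n → smoothRing n U := fun g =>
    Sum.elim (fun _ => F.structureFunctions.connReeb g g)
      (Sum.elim (fun d => F.structureFunctions.connHol d g g)
        (fun d => F.structureFunctions.connBar d g g))
  have hwt : ∀ k, F.structureFunctions.traceConn k = ∑ g, w g k := by
    rintro (⟨⟨⟩⟩ | d | d) <;> rfl
  have hwe : ∀ g k (q : U), eval q (w g k) = (F.conn g g).ap (F.field k) q := by
    rintro g (⟨⟨⟩⟩ | d | d) q
    · exact (F.conn_ap_T g g q.2).symm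
    · exact (F.eval_connHol d g g q).trans (F.conn_ap_Z d g g q.2).symm
    · exact (F.conn_ap_Zbar d g g q.2).symm
  have hr : F.structureFunctions.ricci a b
      = ∑ g, F.structureFunctions.ext (w g) (z a) (zb b) := by
    simp only [CRStructureFunctions.ricci, StructureFunctions.ext, hwt, map_sum,
      Finset.sum_sub_distrib, Finset.mul_sum]
    rw [Finset.sum_comm (s := (Finset.univ : Finset (FrameIndex n)))]
  rw [hs, hr, map_sum]
  refine Finset.sum_congr rfl fun g _ => ?_
  have := F.extd_field (F.conn g g) (z a) (zb b) p.2
  rw [field_z, field_zb] at this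
  rw [this]
  simp only [StructureFunctions.ext, map_sub, map_sum, map_mul, F.eval_E _ (hwe g _), hwe]
  rfl

theorem eval_scal (p : U) : eval p F.structureFunctions.scal = F.scal p := by
  simp only [CRStructureFunctions.scal, map_sum, map_mul, eval_hInv, eval_ricci, scal]

theorem scal_smooth : SmoothFunOn n F.scal U := smoothFunOn_of_eval _ F.eval_scal

theorem divA_smooth (a : Fin n) : SmoothFunOn n (F.divA a) U :=
  smoothFunOn_of_eval _ (F.eval_divTorsion a)

theorem conj_scal {p : M} (hp : p ∈ U) : starRingEnd ℂ (F.scal p) = F.scal p := by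
  have := congrArg (eval ⟨p, hp⟩) F.structureFunctions.conj_scal
  rwa [eval_structureFunctions_conj, eval_scal] at this

theorem conj_hInv (a b : Fin n) {p : M} (hp : p ∈ U) :
    starRingEnd ℂ (F.hInv a b p) = F.hInv b a p :=
  congrArg (eval ⟨p, hp⟩) (F.structureFunctions.conj_hInv a b)

/-- On a pseudo-Einstein manifold of CR dimension at least two, `∇_α R = i n ∇^β A_{αβ}`. -/
theorem grad_scal (hn : 2 ≤ n) (hS : S.IsPseudoEinstein) (a : Fin n) {p : M} (hp : p ∈ U) :
    F.grad F.scal a p = Complex.I * n * F.divA a p := by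
  have hn0 : (n : ℂ) ≠ 0 := by
    have : n ≠ 0 := by omega
    exact_mod_cast this
  -- The Schur argument is applied with `f = R/n`; the factor `1/n` must itself be an element of the
  -- ring.
  let κ : smoothRing n U := restrict _ (smoothFunOn_const (1 / (n : ℂ)) U)
  have h1 := F.structureFunctions.E_eq_divTorsion_of_ricci_eq hn (κ * F.structureFunctions.scal)
    (fun a b => eval_ext fun q => by
      rw [map_mul, map_mul, eval_ricci, eval_scal, eval_h]
      exact sub_eq_zero.1 ((hS U F q q.2).1 hn a b)) a
  have h2 := congrArg (eval ⟨p, hp⟩) h1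
  rw [F.eval_E (f := fun q => 1 / (n : ℂ) * F.scal q) _ (fun q => by
    rw [map_mul, eval_scal]; rfl), map_mul, eval_I, eval_divTorsion,
    CField.D_mul _ F.isOpen (smoothFunOn_const _ U) F.scal_smooth hp, CField.D_const] at h2
  simp only [field_z, mul_zero, add_zero] at h2
  rw [grad]
  field_simp at h2
  linear_combination h2

end AdmissibleFrame

/-! ### Divergences, the sublaplacian and the value of `P₄(1)` -/

namespace AdmissibleFrame

variable {n : ℕ} {M : Type u} [TopologicalSpace M] [ChartedSpace (Model n) M]
  [IsManifold (𝓡 (2 * n + 1)) ∞ M] {S : Pseudohermitian n M} {U : Set M}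
  (F : AdmissibleFrame S U)

theorem div_congr {τ σ : Fin n → M → ℂ} (h : ∀ a, ∀ p ∈ U, τ a p = σ a p) {p : M} (hp : p ∈ U) :
    F.div τ p = F.div σ p := by
  simp only [div, nablaBarForm, CField.D_congr _ F.isOpen (h _) hp, h _ p hp]

theorem div_const_mul (z : ℂ) {τ : Fin n → M → ℂ} (hτ : ∀ a, SmoothFunOn n (τ a) U) {p : M}
    (hp : p ∈ U) : F.div (fun a q => z * τ a q) p = z * F.div τ p := by
  simp only [div, nablaBarForm, Finset.mul_sum,
    CField.D_mul _ F.isOpen (smoothFunOn_const z U) (hτ _) hp, CField.D_const]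
  refine Finset.sum_congr rfl fun a _ => Finset.sum_congr rfl fun b _ => ?_
  have h : ∑ s, (F.conn a s).ap (F.Zbar b) p * (z * τ s p)
      = z * ∑ s, (F.conn a s).ap (F.Zbar b) p * τ s p := by
    rw [Finset.mul_sum]
    exact Finset.sum_congr rfl fun s _ => mul_left_comm _ _ _
  rw [h]
  ring

theorem divBar_congr {τ σ : Fin n → M → ℂ} (h : ∀ a, ∀ p ∈ U, τ a p = σ a p) {p : M}
    (hp : p ∈ U) : F.divBar τ p = F.divBar σ p := by
  simp only [divBar, nablaFormBar, CField.D_congr _ F.isOpen (h _) hp, h _ p hp]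

/-- Both divergences use the same connection and the inverse Levi form is hermitian, so they are
exchanged by conjugation. -/
theorem divBar_conj (τ : Fin n → M → ℂ) {p : M} (hp : p ∈ U) :
    F.divBar (fun a q => starRingEnd ℂ (τ a q)) p = starRingEnd ℂ (F.div τ p) := by
  simp only [divBar, div, map_sum, map_mul]
  rw [Finset.sum_comm]
  refine Finset.sum_congr rfl fun a _ => Finset.sum_congr rfl fun b _ => ?_
  rw [F.conj_hInv a b hp, nablaFormBar, nablaBarForm, map_sub, map_sum, ← CField.D_conj,
    Zbar, CField.conj_conj]
  simp only [map_mul, ← CForm.conj_ap_conj, CField.conj_conj]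

theorem gradBar_eq_conj_grad {f : M → ℂ} (hf : ∀ p ∈ U, starRingEnd ℂ (f p) = f p) (a : Fin n)
    {p : M} (hp : p ∈ U) : F.gradBar f a p = starRingEnd ℂ (F.grad f a p) := by
  rw [gradBar, grad, ← CField.D_conj, CField.D_congr _ F.isOpen hf hp, Zbar]

/-- The sublaplacian of a real-valued function. -/
theorem sublaplacian_of_real {f : M → ℂ} (hf : ∀ p ∈ U, starRingEnd ℂ (f p) = f p)
    {p : M} (hp : p ∈ U) : F.sublaplacian f p = -(2 * ((F.div (F.grad f) p).re : ℂ)) := by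
  rw [sublaplacian, F.divBar_congr (fun a q hq => F.gradBar_eq_conj_grad hf a hq) hp,
    F.divBar_conj _ hp, Complex.add_conj]
  push_cast
  rfl

theorem sublaplacian_const_mul (z : ℝ) {f : M → ℂ} (hf : SmoothFunOn n f U)
    (hf' : ∀ p ∈ U, starRingEnd ℂ (f p) = f p) {p : M} (hp : p ∈ U) :
    F.sublaplacian (fun q => (z : ℂ) * f q) p = z * F.sublaplacian f p := by
  have hg : ∀ a, ∀ q ∈ U, F.grad (fun q => (z : ℂ) * f q) a q = z * F.grad f a q :=
    fun a q hq => by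
      rw [grad, CField.D_mul _ F.isOpen (smoothFunOn_const _ U) hf hq, CField.D_const, mul_zero,
        add_zero, grad]
  rw [F.sublaplacian_of_real (fun q hq => by rw [map_mul, hf' q hq, Complex.conj_ofReal]) hp,
    F.sublaplacian_of_real hf' hp, F.div_congr hg hp,
    F.div_const_mul _ (τ := F.grad f) (fun a => hf.D F.isOpen (F.Z_smooth a)) hp,
      Complex.re_ofReal_mul]
  push_cast
  ring

theorem sublaplacian_schoutenTrace {p : M} (hp : p ∈ U) :
    F.sublaplacian F.schoutenTrace p = F.sublaplacian F.scal p / (2 * ((n : ℂ) + 1)) := by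
  have h : F.schoutenTrace = fun q => (((2 * ((n : ℝ) + 1))⁻¹ : ℝ) : ℂ) * F.scal q := by
    funext q
    rw [schoutenTrace]
    push_cast
    rw [div_eq_inv_mul]
  rw [h, F.sublaplacian_const_mul _ F.scal_smooth (fun q hq => F.conj_scal hq) hp]
  push_cast
  rw [div_eq_inv_mul]

/-- On a pseudo-Einstein manifold of CR dimension at least two,
`Δ_b R = 2 n Im ∇^α ∇^β A_{αβ}`. -/
theorem sublaplacian_scal (hn : 2 ≤ n) (hS : S.IsPseudoEinstein) {p : M} (hp : p ∈ U) :
    F.sublaplacian F.scal p = 2 * n * F.imDivDivA p := by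
  -- Both sides agree because `-2 Re(i n w) = 2n Im w` for `w = ∇^α∇^β A_{αβ}`.
  rw [F.sublaplacian_of_real (fun q hq => F.conj_scal hq) hp,
    F.div_congr (fun a q hq => F.grad_scal hn hS a hq) hp, F.div_const_mul _ F.divA_smooth hp,
    imDivDivA]
  simp
  ring

/-- If Ricci is `(R/n) h`, then `(1/n - 1/(2(n+1)))/(n+2) = 1/(2n(n+1))` makes the Schouten tensor
equal to `(P/n) h`, with no tracefree part. -/
theorem normSqSchoutenTF_eq_zero (hn : 2 ≤ n) (hS : S.IsPseudoEinstein) {p : M} (hp : p ∈ U) :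
    F.normSqSchoutenTF p = 0 := by
  have hn0 : (n : ℂ) ≠ 0 := by
    have : n ≠ 0 := by omega
    exact_mod_cast this
  have hn1 : (n : ℂ) + 1 ≠ 0 := by exact_mod_cast n.succ_ne_zero
  have hn2 : (n : ℂ) + 2 ≠ 0 := by exact_mod_cast (n + 1).succ_ne_zero
  have h : ∀ a b, F.schoutenTF a b p = 0 := fun a b => by
    rw [schoutenTF, schouten, schoutenTrace, sub_eq_zero.1 ((hS U F p hp).1 hn a b)]
    field_simp
    ring
  simp [normSqSchoutenTF, h]

theorem grad_const (z : ℂ) (a : Fin n) : F.grad (fun _ => z) a = fun _ => 0 :=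
  funext fun _ => CField.D_const _ _ _

theorem gradBar_const (z : ℂ) (a : Fin n) : F.gradBar (fun _ => z) a = fun _ => 0 :=
  funext fun _ => CField.D_const _ _ _

theorem nabla0_const (z : ℂ) : F.nabla0 (fun _ => z) = fun _ => 0 :=
  funext fun _ => CField.D_const _ _ _

theorem sublaplacian_const (z : ℂ) : F.sublaplacian (fun _ => z) = fun _ => 0 := by
  funext q
  simp [sublaplacian, div, divBar, nablaBarForm, nablaFormBar, grad_const, gradBar_const,
    CField.D_const]

/-- Every term of `P₄` other than the last differentiates its argument and so vanishes on constants.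
-/
theorem P4_one (p : M) : F.P4 (fun _ => 1) p = ((n : ℂ) - 1) / 2 * F.Q4 p := by
  simp [P4, sublaplacian_const, nabla0_const, grad_const, gradBar_const, gradUp, CField.D_const,
    div, divVecBar, nablaBarForm]

/-- `4/(n-1)² P₄(1)` on a pseudo-Einstein manifold of CR dimension at least two. -/
theorem P4_one_of_isPseudoEinstein (hn : 2 ≤ n) (hS : S.IsPseudoEinstein) {p : M} (hp : p ∈ U) :
    4 / ((n : ℂ) - 1) ^ 2 * F.P4 (fun _ => 1) p = 2 / (n : ℂ) ^ 2 * F.sublaplacian F.scal p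
      - 4 / (n : ℂ) * F.normSqA p + 1 / (n : ℂ) ^ 2 * F.scal p ^ 2 := by
  have hn0 : (n : ℂ) ≠ 0 := by
    have : n ≠ 0 := by omega
    exact_mod_cast this
  have hn1 : (n : ℂ) + 1 ≠ 0 := by exact_mod_cast n.succ_ne_zero
  have hn2 : (n : ℂ) + 2 ≠ 0 := by exact_mod_cast (n + 1).succ_ne_zero
  have hn3 : (n : ℂ) - 1 ≠ 0 := by
    have : n ≠ 1 := by omega
    exact sub_ne_zero.2 (by exact_mod_cast this)
  -- With `Im ∇^α∇^β A_{αβ} = Δ_b R/(2n)`, the coefficient of `Δ_b R` in `Q₄` is `(n+1)/(n(n+2)) -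
  -- 2/(n²(n+2)) = (n-1)/n²`. The coefficients of `|A|²` and `R²` contain `n - 1` explicitly, so the
  -- overall factor `2/(n-1)` leaves no pole.
  rw [P4_one, Q4, F.sublaplacian_schoutenTrace hp, F.normSqSchoutenTF_eq_zero hn hS hp,
    F.sublaplacian_scal hn hS hp, schoutenTrace]
  field_simp
  ring

end AdmissibleFrame

/-! ### Continuation in the dimension -/

/-- The expression `2/n² Δ_b R - 4/n |A|² + 1/n² R²`. -/
def qPrimeExpr : DimExpr where
  -- Over the common denominator `X²` the coefficient `-4/n` becomes `-4X/X²`. The divergence of the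
  -- torsion and `|P̊|²` have coefficient 0.
  num := ![2, 0, -(4 * Polynomial.X), 0, 1]
  den := Polynomial.X ^ 2

theorem qPrimeExpr_value {n : ℕ} (hn : 1 ≤ n) {M : Type u} [TopologicalSpace M]
    [ChartedSpace (Model n) M] [IsManifold (𝓡 (2 * n + 1)) ∞ M] {S : Pseudohermitian n M}
    {U : Set M} (F : AdmissibleFrame S U) (p : M) :
    qPrimeExpr.value F p = 2 / (n : ℂ) ^ 2 * F.sublaplacian F.scal p
      - 4 / (n : ℂ) * F.normSqA p + 1 / (n : ℂ) ^ 2 * F.scal p ^ 2 := by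
  have hn0 : (n : ℂ) ≠ 0 := by
    have : n ≠ 0 := by omega
    exact_mod_cast this
  simp [DimExpr.value, DimExpr.coeff, qPrimeExpr]
  field_simp
  ring

theorem qPrimeExpr_representsQPrime : DimExpr.RepresentsQPrime.{u} qPrimeExpr := by
  refine ⟨fun k hk => ?_, fun k hk N _ _ _ S hS U F p hp => ?_⟩
  · have : k ≠ 0 := by omega
    simpa [qPrimeExpr] using this
  · rw [qPrimeExpr_value (by omega), F.P4_one_of_isPseudoEinstein hk hS hp]

end CRGeometry

end

theorem mainTheorem11 (n : ℕ) (hn : 1 ≤ n) (M : Type*) [TopologicalSpace M]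
    [ChartedSpace (CRGeometry.Model n) M] [IsManifold (𝓡 (2 * n + 1)) ∞ M]
    (S : CRGeometry.Pseudohermitian n M) (hS : S.IsPseudoEinstein)
    (U : Set M) (F : CRGeometry.AdmissibleFrame S U) :
    F.IsQPrime (fun p => 2 / (n : ℂ) ^ 2 * F.sublaplacian F.scal p
      - 4 / (n : ℂ) * F.normSqA p + 1 / (n : ℂ) ^ 2 * F.scal p ^ 2) ∧
    (n = 1 → F.IsQPrime (fun p => 2 * F.sublaplacian F.scal p
      - 4 * F.normSqA p + F.scal p ^ 2)) := by
  have h : F.IsQPrime (fun p => 2 / (n : ℂ) ^ 2 * F.sublaplacian F.scal p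
      - 4 / (n : ℂ) * F.normSqA p + 1 / (n : ℂ) ^ 2 * F.scal p ^ 2) :=
    -- For `n ≠ 1` the bound `1 ≤ n` improves to `2 ≤ n`, where the formula is a computation; for `n
    -- = 1` the witness is `qPrimeExpr`.
    ⟨fun h1 p hp => (F.P4_one_of_isPseudoEinstein (by omega) hS hp).symm,
      fun _ => ⟨_, CRGeometry.qPrimeExpr_representsQPrime,
        fun p _ => (CRGeometry.qPrimeExpr_value hn F p).symm⟩⟩
  refine ⟨h, ?_⟩
  rintro rfl
  simpa using h
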